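/- Let $K$ be a field and let $R=K[x_1,\dots,x_5]$ with the standard grading. Let $f_1,\dots,f_5\in R$ be a regular sequence of quadratic forms, let $\mathfrak f=(f_1,\dots,f_5)$ and $A=R/\mathfrak f$, and let $g_1,g_2,g_3\in R$ be quadratic forms such that $f_1,\dots,f_5,g_1,g_2,g_3$ are linearly independent over $K$. Put $I=\mathfrak f+(g_1,g_2,g_3)$ (a defect-three quadratic ideal), and suppose that the space $$\operatorname{Ann}_{A_1}(g_1,g_2,g_3)=\{a\in A_1 : a g_1=a g_2=a g_3=0 \text{ in } A\}$$ is one-dimensional over $K$. Then $$\mathrm{HF}_{R/I}(3)=\dim_K (R/I)_3=4.$$ Moreover, if $L\in R_1$ is a linear form whose image in $A$ spans $\operatorname{Ann}_{A_1}(g_1,g_2,g_3)$, then the ideal $\mathfrak f$ is generated by a regular sequence $f_1',\dots,f_5'$ of quadratic forms such that some $f_i'$ is divisible by $L$. -/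

import Mathlib

noncomputable section

/-- The degree `d` component `(R/I)_d` of `R/I`, where `R = K[x_1, …, x_n]` has the standard
grading: the image of the space `R_d` of forms of degree `d` (for a homogeneous ideal `I`, this is
the degree `d` component of the induced grading). -/
def gradedPiece {K : Type*} [Field K] {n : ℕ} (I : Ideal (MvPolynomial (Fin n) K)) (d : ℕ) :
    Submodule K (MvPolynomial (Fin n) K ⧸ I) :=
  (MvPolynomial.homogeneousSubmodule (Fin n) K d).map (Ideal.Quotient.mkₐ K I).toLinearMap

/-- The Hilbert function `HF_{R/I}(d) = dim_K (R/I)_d`. -/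
def hilbertFunction {K : Type*} [Field K] {n : ℕ} (I : Ideal (MvPolynomial (Fin n) K)) (d : ℕ) :
    ℕ :=
  Module.finrank K (gradedPiece I d)

/-- `f_1, …, f_n` is a regular sequence of quadratic forms in `K[x_1, …, x_n]`. -/
structure IsQuadraticRegularSequence {K : Type*} [Field K] {n : ℕ}
    (f : Fin n → MvPolynomial (Fin n) K) : Prop where
  isHomogeneous : ∀ i, (f i).IsHomogeneous 2
  isRegular : RingTheory.Sequence.IsRegular (MvPolynomial (Fin n) K) (List.ofFn f)

/-- `(f_1, …, f_n) + (g_1, …, g_δ)` is (presented as) a defect `δ` quadratic ideal: the `f_i` form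
a regular sequence of quadratic forms, the `g_j` are quadratic forms, and the `n + δ` forms are
linearly independent over `K`. As all of them have the same degree, the last condition says that
they generate the ideal minimally. -/
structure IsDefectQuadratic {K : Type*} [Field K] {n δ : ℕ}
    (f : Fin n → MvPolynomial (Fin n) K) (g : Fin δ → MvPolynomial (Fin n) K) : Prop where
  regular : IsQuadraticRegularSequence f
  isHomogeneous : ∀ j, (g j).IsHomogeneous 2
  linearIndependent : LinearIndependent K (Sum.elim f g)

/-- `Ann_{A_1}(g_1, …, g_δ)`, where `A = R/(f_1, …, f_n)`: the space of all elements of degree one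
of `A` that annihilate the ideal of `A` generated by the images of `g_1, …, g_δ`. -/
def linearAnnihilator {K : Type*} [Field K] {n δ : ℕ}
    (f : Fin n → MvPolynomial (Fin n) K) (g : Fin δ → MvPolynomial (Fin n) K) :
    Submodule K (MvPolynomial (Fin n) K ⧸ Ideal.span (Set.range f)) :=
  gradedPiece (Ideal.span (Set.range f)) 1 ⊓
    (((Ideal.span (Set.range g)).map
      (Ideal.Quotient.mk (Ideal.span (Set.range f)))).annihilator).restrictScalars K

end

open MvPolynomial Matrix

/-! Let L be a nonzero linear form with L g_k = ∑ l_kj f_j for each k. The heart of the proof is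
that L M lies in the K-span of the f_j for some nonzero linear form M
(`exists_linear_multiple_mem_span`). Suppose not. Modulo L, in four variables, the images F_j of the
f_j stay independent, and the l_k become three independent linear syzygies a_k of F. Koszul
exactness, applied twice, shows that a_0 ∧ a_k is the contraction with F of a scalar trivector ω_k
(`KoszulExact.exists_trivector`). Then a_0 ∧ ω_k is itself killed by contraction with F. In rank
five its dual vector is proportional to F; if nonzero, it would consist of five independent linear
forms in four variables, so a_0 ∧ ω_k = 0 (`wedgeTrivector_eq_zero`).

Choose the basis so that the nonzero entries of a_0 are independent. Then ω_k is divisible by the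
basis vector of each such entry. Three or more of them make ω_1 and ω_2 dependent, against the
independence of the a_k; a single one is impossible in a domain. With exactly two, all F_j lie in an
ideal generated by two linear forms and one F_q (`exists_mem_span_of_three_relations`). Adding L,
all f_j lie in a proper ideal with four generators, against Krull's height theorem.

Now exchange some f_i for L M. Koszul exactness gives g_k ≡ M v_k modulo (f) with v_k linear. The
forms L, v_0, v_1, v_2 are independent and multiplied by M into I; some f_j, nonzero modulo them,
accounts for the remaining square. So M R_2 ⊆ I and I_3 = ∑_{j≠i} R_1 f_j + M R_2, of dimension (4·5
+ 15) − 4 = 31 in the 35-dimensional R_3. -/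

theorem setOf_mem_take_ofFn {R : Type*} {n : ℕ} (f : Fin n → R) (k : Fin n) :
    {r | r ∈ (List.ofFn f).take k} = f '' Set.Iio k := by
  ext r
  simp only [Set.mem_ofPred_eq, Set.mem_image, Set.mem_Iio, List.mem_take_iff_getElem,
    List.length_ofFn, List.getElem_ofFn]
  constructor
  · rintro ⟨j, hj, rfl⟩
    exact ⟨⟨j, by omega⟩, by simp [Fin.lt_def]; omega, rfl⟩
  · rintro ⟨j, hj, rfl⟩
    exact ⟨j, by have := Fin.lt_def.mp hj; omega, rfl⟩

/-! ### Regular sequences: Koszul relations and Krull's height bound -/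

section RegularSequences

variable {R : Type*} [CommRing R] {n : ℕ}

/-- Multiplication by `f k` is injective modulo the preceding `f j`, for each `k`. -/
def IsSequentiallyRegular (f : Fin n → R) : Prop :=
  ∀ k u, f k * u ∈ Ideal.span (f '' Set.Iio k) → u ∈ Ideal.span (f '' Set.Iio k)

theorem isWeaklyRegular_ofFn_iff (f : Fin n → R) :
    RingTheory.Sequence.IsWeaklyRegular R (List.ofFn f) ↔ IsSequentiallyRegular f := by
  rw [RingTheory.Sequence.isWeaklyRegular_iff]
  have key : ∀ k : Fin n, (IsSMulRegular (R ⧸ (Ideal.ofList ((List.ofFn f).take k) • ⊤ :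
      Submodule R R)) (f k) ↔
      ∀ u, f k * u ∈ Ideal.span (f '' Set.Iio k) → u ∈ Ideal.span (f '' Set.Iio k)) := by
    intro k
    have h : (Ideal.ofList ((List.ofFn f).take k) • ⊤ : Submodule R R) =
        Ideal.span (f '' Set.Iio k) := by
      rw [← setOf_mem_take_ofFn]
      simp [Ideal.ofList]
    rw [h, isSMulRegular_iff_right_eq_zero_of_smul]
    constructor
    · intro H u hu
      rw [← Submodule.Quotient.mk_eq_zero]
      apply H
      rw [← Submodule.Quotient.mk_smul, Submodule.Quotient.mk_eq_zero]
      exact hu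
    · intro H u hu
      induction u using Submodule.Quotient.induction_on with
      | _ u =>
      rw [← Submodule.Quotient.mk_smul, Submodule.Quotient.mk_eq_zero] at hu
      rw [Submodule.Quotient.mk_eq_zero]
      exact H u hu
  constructor
  · intro H k
    exact (key k).1 (by simpa using H k (by simp))
  · intro H i hi
    simpa using (key ⟨i, by simpa using hi⟩).2 (H _)

/-- Every relation `∑ b_j f_j = 0` is a combination of the trivial ones. -/
def KoszulExact {ι : Type*} [Fintype ι] (f : ι → R) : Prop :=
  ∀ b : ι → R, b ⬝ᵥ f = 0 → ∃ u : Matrix ι ι R, b = (u - u.transpose) *ᵥ f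

theorem exists_coeff_of_mem_span_image (f : Fin n → R) (s : Set (Fin n)) {x : R}
    (hx : x ∈ Ideal.span (f '' s)) :
    ∃ d : Fin n → R, (∀ j ∉ s, d j = 0) ∧ x = ∑ j, d j * f j := by
  obtain ⟨l, hl, rfl⟩ := (Finsupp.mem_span_image_iff_linearCombination R).1 hx
  refine ⟨l, fun j hj => ?_, ?_⟩
  · by_contra h
    exact hj (hl (Finsupp.mem_support_iff.2 h))
  · rw [Finsupp.linearCombination_apply, Finsupp.sum_fintype] <;> simp

/-- Induction on the number of indices supporting the relation: regularity puts the last coefficient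
in the ideal of the preceding `f j`, and trivial relations then remove it. -/
theorem IsSequentiallyRegular.koszulExact {f : Fin n → R} (hf : IsSequentiallyRegular f) :
    KoszulExact f := by
  have key : ∀ k ≤ n, ∀ b : Fin n → R, (∀ j : Fin n, k ≤ j → b j = 0) → ∑ j, b j * f j = 0 →
      ∃ u : Matrix (Fin n) (Fin n) R, ∀ j, b j = ∑ p, (u j p - u p j) * f p := by
    intro k
    induction k with
    | zero =>
      intro _ b hb _
      exact ⟨0, fun j => by simp [hb j (Nat.zero_le _)]⟩
    | succ k ih =>
      intro hk b hb hsum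
      set i : Fin n := ⟨k, hk⟩
      have hmem : f i * b i ∈ Ideal.span (f '' Set.Iio i) := by
        have : f i * b i = - ∑ j ∈ Finset.univ.erase i, b j * f j := by
          rw [← Finset.add_sum_erase _ _ (Finset.mem_univ i)] at hsum
          linear_combination hsum
        rw [this]
        refine Ideal.neg_mem_iff _ |>.2 (Ideal.sum_mem _ fun j hj => ?_)
        rcases lt_or_ge j i with h | h
        · exact Ideal.mul_mem_left _ _ (Ideal.subset_span ⟨j, h, rfl⟩)
        · have : i < j := lt_of_le_of_ne h (Ne.symm (Finset.ne_of_mem_erase hj))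
          rw [hb j (by simpa [i, Fin.lt_def] using this)]
          simp
      obtain ⟨d, hd, hbd⟩ := exists_coeff_of_mem_span_image f _ (hf i _ hmem)
      have hdi : d i = 0 := hd i (by simp)
      -- Adding the trivial relations `d j` · (`f i` e_j − `f j` e_i) to `b` clears the entry `i`.
      obtain ⟨u, hu⟩ := ih (by omega) (fun j => if j = i then 0 else b j + d j * f i)
        (by
          intro j hj
          by_cases h : j = i
          · simp [h]
          · have h1 : i < j := lt_of_le_of_ne (by simpa [i, Fin.le_def] using hj) (Ne.symm h)
            simp [h, hb j (by simpa [i, Fin.lt_def] using h1), hd j (by simpa using h1.le)])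
        (by
          rw [← Finset.add_sum_erase _ _ (Finset.mem_univ i)]
          rw [← Finset.add_sum_erase _ _ (Finset.mem_univ i)] at hsum hbd
          have : ∑ j ∈ Finset.univ.erase i, (if j = i then 0 else b j + d j * f i) * f j =
            ∑ j ∈ Finset.univ.erase i, b j * f j +
              f i * ∑ j ∈ Finset.univ.erase i, d j * f j := by
            rw [Finset.mul_sum, ← Finset.sum_add_distrib]
            refine Finset.sum_congr rfl fun j hj => ?_
            rw [if_neg (Finset.ne_of_mem_erase hj)]
            ring
          rw [this]
          simp only [if_true]
          rw [hdi] at hbd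
          linear_combination hsum - f i * hbd)
      refine ⟨fun j p => u j p + (if j = i then d p else 0), fun j => ?_⟩
      have := hu j
      simp only [sub_mul, add_mul, Finset.sum_sub_distrib, Finset.sum_add_distrib,
        ite_mul, zero_mul, Finset.sum_ite_eq', Finset.mem_univ, if_true] at this ⊢
      by_cases h : j = i
      · subst h
        simp only [hdi, ← hbd, if_true] at this ⊢
        linear_combination this
      · simp only [h, if_false, Finset.sum_const_zero] at this ⊢
        linear_combination this
  intro b hb
  obtain ⟨u, hu⟩ := key n le_rfl b (fun j hj => absurd j.2 (by omega)) hb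
  exact ⟨u, funext hu⟩

/-- `KoszulExact` is invariant under invertible linear substitutions. -/
theorem KoszulExact.of_eq_mulVec {ι : Type*} [Fintype ι] [DecidableEq ι] {f f' : ι → R}
    (hf : KoszulExact f) (G H : Matrix ι ι R) (hGH : G * H = 1) (hG : f' = G *ᵥ f)
    (hH : f = H *ᵥ f') : KoszulExact f' := by
  intro b hb
  obtain ⟨u, hu⟩ := hf (b ᵥ* G) (by rw [← Matrix.dotProduct_mulVec, ← hG, hb])
  refine ⟨H.transpose * u * H, ?_⟩
  have h1 : b = (b ᵥ* G) ᵥ* H := by rw [Matrix.vecMul_vecMul, hGH, Matrix.vecMul_one]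
  rw [h1, hu, ← Matrix.mulVec_transpose]
  conv_lhs => rw [hH]
  rw [Matrix.mulVec_mulVec, Matrix.mulVec_mulVec]
  congr 1
  simp [Matrix.mul_sub, Matrix.sub_mul, Matrix.mul_assoc]

/-- A regular sequence is not contained in a proper ideal with fewer generators. -/
theorem IsSequentiallyRegular.span_eq_top_of_le [IsNoetherianRing R] {f : Fin n → R}
    (hf : IsSequentiallyRegular f) (s : Set R) (hs : s.Finite) (hcard : s.ncard < n)
    (hle : ∀ j, f j ∈ Ideal.span s) : Ideal.span s = ⊤ := by
  by_contra hne
  obtain ⟨p, hp⟩ := Ideal.nonempty_minimalPrimes hne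
  have hprime : p.IsPrime := hp.isPrime
  -- Krull bounds the height of `p` by the number of generators, while `f` stays regular in the
  -- localization at `p` and forces height at least `n`.
  have hh := Ideal.height_le_card_of_mem_minimalPrimes_span hs hp
  have hreg := ((isWeaklyRegular_ofFn_iff f).2 hf).isRegular_of_isLocalization_of_mem
    (Localization.AtPrime p) p (by
      intro r hr
      obtain ⟨j, rfl⟩ := (List.mem_ofFn' _ _).1 hr
      exact hp.1.2 (hle j))
  have hnoeth : IsNoetherianRing (Localization.AtPrime p) :=
    IsLocalization.isNoetherianRing p.primeCompl _ inferInstance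
  have hdim := ringKrullDim_add_length_eq_ringKrullDim_of_isRegular _ hreg
  rw [IsLocalization.AtPrime.ringKrullDim_eq_height p (Localization.AtPrime p)] at hdim
  have hnt : Nontrivial (Localization.AtPrime p ⧸
      Ideal.ofList ((List.ofFn f).map (algebraMap R (Localization.AtPrime p)))) := by
    rw [Ideal.Quotient.nontrivial_iff]
    intro h
    exact hreg.2 (by rw [h]; simp)
  have h0 := @ringKrullDim_nonneg_of_nontrivial _ _ hnt
  have h1 : (n : WithBot ℕ∞) ≤ p.height := by
    rw [← hdim]
    simp only [List.length_map, List.length_ofFn]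
    exact le_add_of_nonneg_left h0
  have h2 : (n : ℕ∞) ≤ p.height := by exact_mod_cast h1
  have h3 := h2.trans hh
  exact absurd (by exact_mod_cast h3) (not_le.2 hcard)

end RegularSequences

/-! ### Relations among forms of equal degree, graded version -/

section HomogeneousRelations

variable {K : Type*} [Field K] {σ : Type*}

theorem homogeneousComponent_mul_of_isHomogeneous {m : ℕ} (d : ℕ) (p : MvPolynomial σ K)
    {f : MvPolynomial σ K} (hf : f.IsHomogeneous m) :
    homogeneousComponent (d + m) (p * f) = homogeneousComponent d p * f := by
  induction p using MvPolynomial.induction_on' with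
  | monomial a c =>
    have h := isHomogeneous_monomial (n := a.degree) c rfl
    rw [homogeneousComponent_of_mem (h.mul hf), homogeneousComponent_of_mem h]
    simp
  | add p q hp hq => rw [add_mul, map_add, hp, hq, map_add, add_mul]

theorem homogeneousComponent_mul_eq_zero {d m : ℕ} (hd : d < m) (p : MvPolynomial σ K)
    {f : MvPolynomial σ K} (hf : f.IsHomogeneous m) : homogeneousComponent d (p * f) = 0 := by
  induction p using MvPolynomial.induction_on' with
  | monomial a c =>
    have h := isHomogeneous_monomial (n := a.degree) c rfl
    rw [homogeneousComponent_of_mem (h.mul hf), if_neg (by omega)]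
  | add p q hp hq => rw [add_mul, map_add, hp, hq, add_zero]

theorem exists_eq_C_of_isHomogeneous_zero {p : MvPolynomial σ K} (hp : p.IsHomogeneous 0) :
    ∃ c : K, p = C c :=
  ⟨_, (totalDegree_eq_zero_iff_eq_C.1 ((totalDegree_zero_iff_isHomogeneous _).2 hp))⟩

variable {ι : Type*} [Fintype ι] {f : ι → MvPolynomial σ K}

theorem exists_homogeneous_coeff {m d : ℕ} (hf : ∀ j, (f j).IsHomogeneous m)
    {x : MvPolynomial σ K} (hx : x.IsHomogeneous (d + m)) (h : x ∈ Ideal.span (Set.range f)) :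
    ∃ c : ι → MvPolynomial σ K, (∀ j, (c j).IsHomogeneous d) ∧ x = ∑ j, c j * f j := by
  obtain ⟨c, rfl⟩ := (Ideal.mem_span_range_iff_exists_fun).1 h
  refine ⟨fun j => homogeneousComponent d (c j), fun j => homogeneousComponent_isHomogeneous _ _, ?_⟩
  conv_lhs => rw [← homogeneousComponent_eq_self hx, map_sum]
  exact Finset.sum_congr rfl fun j _ => homogeneousComponent_mul_of_isHomogeneous d _ (hf j)

theorem exists_scalar_coeff {m : ℕ} (hf : ∀ j, (f j).IsHomogeneous m)
    {x : MvPolynomial σ K} (hx : x.IsHomogeneous m) (h : x ∈ Ideal.span (Set.range f)) :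
    ∃ c : ι → K, x = ∑ j, C (c j) * f j := by
  obtain ⟨c, hc, hxc⟩ := exists_homogeneous_coeff (d := 0) hf (by simpa using hx) h
  choose c' hc' using fun j => exists_eq_C_of_isHomogeneous_zero (hc j)
  exact ⟨c', by simp [hxc, ← hc']⟩

/-- Multiplication by forms of degree `m` shifts the grading by `m`, so the Koszul coefficients may
be replaced by their components of degree `d`. -/
theorem KoszulExact.exists_homogeneous {m d : ℕ} (hk : KoszulExact f)
    (hf : ∀ j, (f j).IsHomogeneous m) {b : ι → MvPolynomial σ K}
    (hb : ∀ j, (b j).IsHomogeneous (d + m)) (h : ∑ j, b j * f j = 0) :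
    ∃ u : ι → ι → MvPolynomial σ K, (∀ j p, (u j p).IsHomogeneous d) ∧
      ∀ j, b j = ∑ p, (u j p - u p j) * f p := by
  obtain ⟨u, hu⟩ := hk b h
  refine ⟨fun j p => homogeneousComponent d (u j p),
    fun j p => homogeneousComponent_isHomogeneous _ _, fun j => ?_⟩
  conv_lhs => rw [← homogeneousComponent_eq_self (hb j), hu]
  simp only [mulVec, dotProduct, map_sum, Matrix.sub_apply, Matrix.transpose_apply]
  refine Finset.sum_congr rfl fun p _ => ?_
  rw [homogeneousComponent_mul_of_isHomogeneous d _ (hf p), map_sub]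

theorem KoszulExact.exists_scalar {m : ℕ} (hk : KoszulExact f)
    (hf : ∀ j, (f j).IsHomogeneous m) {b : ι → MvPolynomial σ K}
    (hb : ∀ j, (b j).IsHomogeneous m) (h : ∑ j, b j * f j = 0) :
    ∃ u : ι → ι → K, ∀ j, b j = ∑ p, C (u j p - u p j) * f p := by
  obtain ⟨u, hu, hbu⟩ := hk.exists_homogeneous (d := 0) hf (by simpa using hb) h
  choose u' hu' using fun j p => exists_eq_C_of_isHomogeneous_zero (hu j p)
  refine ⟨u', fun j => ?_⟩
  rw [hbu j]
  simp [← hu']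

/-- A Koszul relation has its coefficients in the ideal of the `f j`, which has nothing in degrees
below `m`. -/
theorem KoszulExact.eq_zero_of_lt {m d : ℕ} (hk : KoszulExact f) (hdm : d < m)
    (hf : ∀ j, (f j).IsHomogeneous m) {b : ι → MvPolynomial σ K}
    (hb : ∀ j, (b j).IsHomogeneous d) (h : ∑ j, b j * f j = 0) (j : ι) : b j = 0 := by
  obtain ⟨u, hu⟩ := hk b h
  rw [← homogeneousComponent_eq_self (hb j), hu]
  simp only [mulVec, dotProduct, map_sum]
  exact Finset.sum_eq_zero fun p _ => homogeneousComponent_mul_eq_zero hdm _ (hf p)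

/-- Two linear multiples of `L` in the span of the quadrics `f j` are proportional. -/
theorem KoszulExact.mul_eq_mul (hk : KoszulExact f)
    (hf : ∀ j, (f j).IsHomogeneous 2) {L M N : MvPolynomial σ K} (hM : M.IsHomogeneous 1)
    (hN : N.IsHomogeneous 1) {α β : ι → K} (h1 : L * M = ∑ j, C (α j) * f j)
    (h2 : L * N = ∑ j, C (β j) * f j) (j : ι) : C (β j) * M = C (α j) * N := by
  -- The identity M · (L N) = N · (L M) is a relation on `f` with linear coefficients, too low in
  -- degree to be nonzero.
  have := hk.eq_zero_of_lt (b := fun j => C (β j) * M - C (α j) * N) one_lt_two hf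
    (fun j => (hM.C_mul _).sub (hN.C_mul _)) (by
      have e1 : ∑ j, (C (β j) * M - C (α j) * N) * f j =
        M * ∑ j, C (β j) * f j - N * ∑ j, C (α j) * f j := by
        rw [Finset.mul_sum, Finset.mul_sum, ← Finset.sum_sub_distrib]
        exact Finset.sum_congr rfl fun j _ => by ring
      rw [e1, ← h1, ← h2]; ring) j
  exact sub_eq_zero.1 this

end HomogeneousRelations

/-! ### Linear forms: dimensions, elimination, divisibility -/

section LinearForms

variable {K : Type*} [Field K] {n : ℕ}

theorem finrank_homogeneousSubmodule (n d : ℕ) :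
    Module.finrank K (homogeneousSubmodule (Fin n) K d) = (n + d - 1).choose d := by
  have h : homogeneousSubmodule (Fin n) K d = Submodule.span K (Set.range
      fun s : Finset.finsuppAntidiag (Finset.univ : Finset (Fin n)) d =>
        monomial (s : Fin n →₀ ℕ) (1 : K)) := by
    rw [homogeneousSubmodule_eq_finsupp_supported, AddMonoidAlgebra.supported_eq_span_single]
    congr 1
    ext p
    simp only [Set.mem_image, Set.mem_ofPred_eq, Set.mem_range, Subtype.exists,
      Finset.mem_finsuppAntidiag, Finsupp.degree_eq_sum]
    constructor
    · rintro ⟨x, hx, rfl⟩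
      exact ⟨x, ⟨hx, Finset.subset_univ _⟩, rfl⟩
    · rintro ⟨x, ⟨hx, _⟩, rfl⟩
      exact ⟨x, hx, rfl⟩
  rw [h, finrank_span_eq_card]
  · simp [Finset.card_finsuppAntidiag_nat_eq_choose]
  · have := (basisMonomials (Fin n) K).linearIndependent
    simpa [Function.comp_def] using this.comp
      (fun s : Finset.finsuppAntidiag (Finset.univ : Finset (Fin n)) d => (s : Fin n →₀ ℕ))
      Subtype.val_injective

instance (d : ℕ) : Module.Finite K (homogeneousSubmodule (Fin n) K d) :=
  Module.Finite.iff_fg.2 (homogeneousSubmodule_fg (Fin n) K d)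

theorem exists_linear_coeff {L : MvPolynomial (Fin n) K} (hL : L.IsHomogeneous 1) :
    ∃ a : Fin n → K, L = ∑ i, C (a i) * X i := by
  have : L ∈ Submodule.span K (Set.range (X : Fin n → MvPolynomial (Fin n) K)) := by
    rw [← homogeneousSubmodule_one_eq_span_X]; exact hL
  obtain ⟨a, rfl⟩ := (Submodule.mem_span_range_iff_exists_fun K).1 this
  exact ⟨a, by simp [smul_eq_C_mul]⟩

/-- Elimination of a variable by means of a nonzero linear form. -/
theorem exists_projection {L : MvPolynomial (Fin (n + 1)) K} (hL : L.IsHomogeneous 1)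
    (hL0 : L ≠ 0) :
    ∃ π : MvPolynomial (Fin (n + 1)) K →ₐ[K] MvPolynomial (Fin n) K,
      Function.Surjective π ∧ (∀ d p, p.IsHomogeneous d → (π p).IsHomogeneous d) ∧
      RingHom.ker π = Ideal.span {L} := by
  obtain ⟨a, ha⟩ := exists_linear_coeff hL
  obtain ⟨i, hi⟩ : ∃ i, a i ≠ 0 := by
    by_contra! h
    exact hL0 (by rw [ha]; simp [h])
  -- The value of the variable `i` obtained by solving `L = 0`.
  set y : MvPolynomial (Fin n) K := - ∑ j, C ((a i)⁻¹ * a (i.succAbove j)) * X j with hy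
  have hyh : y.IsHomogeneous 1 :=
    (IsHomogeneous.sum _ _ _ fun j _ => isHomogeneous_C_mul_X _ _).neg
  set v : Fin (n + 1) → MvPolynomial (Fin n) K := i.insertNth y X with hv
  have hvi : v i = y := by simp [hv]
  have hvj : ∀ j, v (i.succAbove j) = X j := fun j => by simp [hv]
  have hC : (C (a i) * C (a i)⁻¹ : MvPolynomial (Fin n) K) = 1 := by
    rw [← map_mul, mul_inv_cancel₀ hi, map_one]
  have hπL : aeval v L = 0 := by
    rw [ha, Fin.sum_univ_succAbove _ i]
    simp only [map_add, map_sum, map_mul, aeval_X, hvi, hvj, hy, algHom_C, algebraMap_eq, map_mul]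
    rw [mul_neg, Finset.mul_sum, neg_add_eq_zero]
    refine Finset.sum_congr rfl fun j _ => ?_
    linear_combination (C (a (i.succAbove j)) * X j) * hC
  -- Eliminating the variable changes nothing modulo `L`; hence whatever is sent to zero is a
  -- multiple of `L`.
  have hσ : ∀ p, Ideal.Quotient.mkₐ K (Ideal.span {L}) (rename i.succAbove (aeval v p)) =
      Ideal.Quotient.mkₐ K (Ideal.span {L}) p := by
    have : ((Ideal.Quotient.mkₐ K (Ideal.span {L})).comp (rename i.succAbove)).comp (aeval v) =
        Ideal.Quotient.mkₐ K (Ideal.span {L}) := by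
      ext k
      rcases Fin.eq_self_or_eq_succAbove i k with rfl | ⟨j, rfl⟩
      · simp only [AlgHom.comp_apply, aeval_X, hvi]
        refine (Ideal.Quotient.eq).2 (Ideal.mem_span_singleton'.2 ⟨- C (a k)⁻¹, ?_⟩)
        rw [ha, Fin.sum_univ_succAbove _ k, hy]
        simp only [map_neg, map_sum, map_mul, rename_X, rename_C]
        rw [mul_add, ← mul_assoc, neg_mul, ← C_mul, inv_mul_cancel₀ hi, neg_mul, Finset.mul_sum]
        simp only [C_1, mul_assoc, neg_mul, Finset.sum_neg_distrib]
        ring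
      · simp [hvj]
    exact fun p => DFunLike.congr_fun this p
  refine ⟨aeval v, fun p => ⟨rename i.succAbove p, ?_⟩, fun d p hp => ?_, ?_⟩
  · rw [aeval_rename]
    have : v ∘ i.succAbove = X := funext hvj
    rw [this, aeval_X_left_apply]
  · have := hp.aeval v (n := 1) fun k => by
      rcases Fin.eq_self_or_eq_succAbove i k with rfl | ⟨j, rfl⟩
      · rw [hvi]; exact hyh
      · rw [hvj]; exact isHomogeneous_X _ _
    simpa using this
  · refine le_antisymm (fun p hp => ?_) ?_
    · rw [RingHom.mem_ker] at hp
      have := hσ p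
      rw [show aeval v p = 0 from hp] at this
      rw [map_zero, map_zero] at this
      exact (Ideal.Quotient.eq_zero_iff_mem).1 this.symm
    · rw [Ideal.span_singleton_le_iff_mem, RingHom.mem_ker]
      exact hπL

theorem prime_of_isHomogeneous_one {a : MvPolynomial (Fin n) K} (ha : a.IsHomogeneous 1)
    (ha0 : a ≠ 0) : Prime a := by
  refine (irreducible_of_totalDegree_eq_one (ha.totalDegree ha0) fun x hx => ?_).prime
  obtain ⟨d, hd⟩ := ne_zero_iff.1 ha0
  refine isUnit_iff_ne_zero.2 ?_
  rintro rfl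
  exact hd (zero_dvd_iff.1 (hx d))

theorem eq_C_mul_of_dvd {d : ℕ} {a b : MvPolynomial (Fin n) K} (ha : a.IsHomogeneous d)
    (hb : b.IsHomogeneous d) (h : a ∣ b) : ∃ c : K, b = C c * a := by
  obtain ⟨q, rfl⟩ := h
  refine ⟨coeff 0 q, ?_⟩
  rw [← homogeneousComponent_zero, ← homogeneousComponent_mul_of_isHomogeneous 0 q ha,
    mul_comm a q, zero_add, homogeneousComponent_eq_self (by rwa [mul_comm])]

/-- A syzygy of two independent linear forms with linear coefficients is trivial. -/
theorem exists_eq_C_mul_of_mul_eq_mul {a b x y : MvPolynomial (Fin n) K} (ha : a.IsHomogeneous 1)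
    (hb : b.IsHomogeneous 1) (hx : x.IsHomogeneous 1) (hab : ∀ c : K, b ≠ C c * a) (ha0 : a ≠ 0)
    (h : a * y = b * x) : ∃ c : K, x = C c * a := by
  rcases (prime_of_isHomogeneous_one ha ha0).dvd_or_dvd (Dvd.intro _ h) with h1 | h1
  · obtain ⟨c, hc⟩ := eq_C_mul_of_dvd ha hb h1
    exact absurd hc (hab c)
  · exact eq_C_mul_of_dvd ha hx h1

end LinearForms

/-! ### Trivectors attached to linear syzygies -/

section LinearSyzygies

variable {K : Type*} [Field K]

/-- A basis of a complement of the kernel, followed by one of the kernel. Applied to the entries of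
a syzygy, it makes the first `r` entries independent and the others zero. -/
theorem exists_adapted_basis {V W : Type*} [AddCommGroup V] [Module K V] [AddCommGroup W]
    [Module K W] [FiniteDimensional K V] {n : ℕ} (hn : Module.finrank K V = n) (φ : V →ₗ[K] W) :
    ∃ (B : Module.Basis (Fin n) K V) (r : ℕ), (∀ j : Fin n, r ≤ j → φ (B j) = 0) ∧
      ∀ α : Fin n → K, ∑ j, α j • φ (B j) = 0 → ∀ j : Fin n, j < r → α j = 0 := by
  obtain ⟨N, hN⟩ := Submodule.exists_isCompl (LinearMap.ker φ)
  set r := Module.finrank K N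
  set s := Module.finrank K (LinearMap.ker φ)
  have hrs : r + s = n := by
    rw [← hn, ← Submodule.finrank_add_eq_of_isCompl hN, add_comm]
  let b := ((Module.finBasis K N).prod (Module.finBasis K (LinearMap.ker φ))).map
    (Submodule.prodEquivOfIsCompl N _ hN.symm)
  let e : Fin r ⊕ Fin s ≃ Fin n := finSumFinEquiv.trans (finCongr hrs)
  have hl : ∀ i, (b.reindex e) (e (Sum.inl i)) = Module.finBasis K N i := fun i => by simp [b]
  have hr : ∀ i, (b.reindex e) (e (Sum.inr i)) = Module.finBasis K (LinearMap.ker φ) i :=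
    fun i => by simp [b]
  have hker : ∀ i, φ (b.reindex e (e (Sum.inr i))) = 0 := fun i => by
    rw [hr]; exact (Module.finBasis K (LinearMap.ker φ) i).2
  refine ⟨b.reindex e, r, fun j hj => ?_, fun α hα j hj => ?_⟩
  · obtain ⟨i | i, rfl⟩ := e.surjective j
    · exact absurd hj (by simp [e])
    · exact hker i
  · rw [← e.sum_comp, Fintype.sum_sum_type] at hα
    simp only [hker, smul_zero, Finset.sum_const_zero, add_zero, hl] at hα
    have h0 : φ ((∑ i, α (e (Sum.inl i)) • Module.finBasis K N i : N) : V) = 0 := by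
      simpa using hα
    have h1 : ((∑ i, α (e (Sum.inl i)) • Module.finBasis K N i : N) : V) = 0 :=
      Submodule.disjoint_def.1 hN.disjoint _ h0 (Submodule.coe_mem _)
    have h2 := Fintype.linearIndependent_iff.1 (Module.finBasis K N).linearIndependent
      (fun i => α (e (Sum.inl i))) (by exact_mod_cast h1)
    obtain ⟨i | i, rfl⟩ := e.surjective j
    · exact h2 i
    · exact absurd hj (by simp [e])

/-- The coordinates of an alternating trivector. -/
structure IsTrivector {ι : Type*} (v : ι → ι → ι → K) : Prop where
  zero_left : ∀ j q, v j j q = 0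
  zero_right : ∀ j q, v j q q = 0
  swap_left : ∀ j p q, v j p q = - v p j q
  swap_right : ∀ j p q, v j p q = - v j q p

/-- The coordinates of the product of a vector and a trivector. -/
def wedgeTrivector {ι : Type*} {A : Type*} [CommRing A] [Algebra K A] (c : ι → A)
    (v : ι → ι → ι → K) (j p r q : ι) : A :=
  v p r q • c j - v j r q • c p + v j p q • c r - v j p r • c q

section

variable {ι : Type*} {A : Type*} [CommRing A] [Algebra K A] {c : ι → A} {v : ι → ι → ι → K}

theorem IsTrivector.zero_outer (hv : IsTrivector v) (j q : ι) : v j q j = 0 := by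
  rw [hv.swap_right, hv.zero_left, neg_zero]

theorem wedgeTrivector_swap_right (hv : IsTrivector v) (j p r q : ι) :
    wedgeTrivector c v j p r q = - wedgeTrivector c v j p q r := by
  simp only [wedgeTrivector]
  rw [hv.swap_right p r q, hv.swap_right j r q]
  module

theorem wedgeTrivector_swap_middle (hv : IsTrivector v) (j p r q : ι) :
    wedgeTrivector c v j p r q = - wedgeTrivector c v j r p q := by
  simp only [wedgeTrivector]
  rw [hv.swap_left p r q, hv.swap_right j p r]
  module

theorem wedgeTrivector_swap_left (hv : IsTrivector v) (j p r q : ι) :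
    wedgeTrivector c v j p r q = - wedgeTrivector c v p j r q := by
  simp only [wedgeTrivector]
  rw [hv.swap_left j p q, hv.swap_left j p r]
  module

/-- If the exterior product of the relation `c` with `a` is the contraction of the trivector `v`,
then `c ∧ v` is a relation. -/
theorem sum_wedgeTrivector_mul [Fintype ι] {F a : ι → A} (hc : ∑ j, c j * F j = 0)
    (hM : ∀ j p, c j * a p - c p * a j = ∑ q, v j p q • F q) (j p r : ι) :
    ∑ q, wedgeTrivector c v j p r q * F q = 0 := by
  have h : ∑ q, wedgeTrivector c v j p r q * F q =
      c j * ∑ q, v p r q • F q - c p * ∑ q, v j r q • F q + c r * ∑ q, v j p q • F q -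
        v j p r • ∑ q, c q * F q := by
    simp only [Finset.mul_sum, ← Finset.sum_sub_distrib,
      ← Finset.sum_add_distrib, wedgeTrivector, Algebra.smul_def]
    exact Finset.sum_congr rfl fun q _ => by ring
  rw [h, hc, ← hM, ← hM, ← hM, smul_zero]
  ring

/-- The hypothesis `hsum` says that the five indices exhaust `ι`. The alternating tensor vanishes on
repeated indices, so two terms of the contraction survive. -/
theorem wedgeTrivector_mul_add [Fintype ι] {F a : ι → A} (hv : IsTrivector v)
    (hc : ∑ j, c j * F j = 0)
    (hM : ∀ j p, c j * a p - c p * a j = ∑ q, v j p q • F q) (j p r q s : ι)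
    (hsum : ∀ φ : ι → A, ∑ i, φ i = φ j + φ p + φ r + φ q + φ s) :
    wedgeTrivector c v j p r q * F q + wedgeTrivector c v j p r s * F s = 0 := by
  have h := sum_wedgeTrivector_mul hc hM j p r
  have h1 : wedgeTrivector c v j p r j = 0 := by
    simp only [wedgeTrivector, hv.zero_outer, hv.swap_right p r j, hv.swap_left p j r]
    module
  have h2 : wedgeTrivector c v j p r p = 0 := by
    simp only [wedgeTrivector, hv.zero_outer, hv.zero_right, hv.swap_right j r p]
    module
  have h3 : wedgeTrivector c v j p r r = 0 := by
    simp only [wedgeTrivector, hv.zero_right]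
    module
  rw [hsum, h1, h2, h3] at h
  linear_combination h

end

/-- If the relation `c` consists of linear forms in four variables and `c ∧ a` is the contraction
of the trivector `v`, then `c ∧ v = 0`. -/
theorem wedgeTrivector_eq_zero {F c a : Fin 5 → MvPolynomial (Fin 4) K}
    {v : Fin 5 → Fin 5 → Fin 5 → K} (hF : LinearIndependent K F)
    (hcl : ∀ j, (c j).IsHomogeneous 1) (hv : IsTrivector v) (hc : ∑ j, c j * F j = 0)
    (hM : ∀ j p, c j * a p - c p * a j = ∑ q, v j p q • F q) {j p r q : Fin 5}
    (hjp : j < p) (hpr : p < r) (hrq : r < q) : wedgeTrivector c v j p r q = 0 := by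
  set Z := wedgeTrivector c v with hZ
  -- The dual vector of the 4-vector `Z`: up to sign, `E s` is the coordinate of `Z` that omits `s`.
  let E : Fin 5 → MvPolynomial (Fin 4) K :=
    ![Z 1 2 3 4, - Z 0 2 3 4, Z 0 1 3 4, - Z 0 1 2 4, Z 0 1 2 3]
  have hZl : ∀ j p r q, (Z j p r q).IsHomogeneous 1 := fun j p r q => by
    have : ∀ (x : K) j, (x • c j).IsHomogeneous 1 := fun x j => by
      rw [smul_eq_C_mul]; exact (hcl j).C_mul x
    exact (((this _ _).sub (this _ _)).add (this _ _)).sub (this _ _)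
  have hEl : ∀ s, (E s).IsHomogeneous 1 := by
    intro s
    fin_cases s <;> simp only [E] <;> first | exact hZl _ _ _ _ | exact (hZl _ _ _ _).neg
  have key := wedgeTrivector_mul_add hv hc hM
  rw [← hZ] at key
  have sR := wedgeTrivector_swap_right (c := c) hv
  have sM := wedgeTrivector_swap_middle (c := c) hv
  have sL := wedgeTrivector_swap_left (c := c) hv
  rw [← hZ] at sR sM sL
  have h34 := key 0 1 2 3 4 (fun φ => by rw [Fin.sum_univ_five])
  have h24 := key 0 1 3 2 4 (fun φ => by rw [Fin.sum_univ_five]; ring)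
  have h23 := key 0 1 4 2 3 (fun φ => by rw [Fin.sum_univ_five]; ring)
  have h14 := key 0 2 3 1 4 (fun φ => by rw [Fin.sum_univ_five]; ring)
  have h13 := key 0 2 4 1 3 (fun φ => by rw [Fin.sum_univ_five]; ring)
  have h12 := key 0 3 4 1 2 (fun φ => by rw [Fin.sum_univ_five]; ring)
  have h04 := key 1 2 3 0 4 (fun φ => by rw [Fin.sum_univ_five]; ring)
  have h03 := key 1 2 4 0 3 (fun φ => by rw [Fin.sum_univ_five]; ring)
  have h02 := key 1 3 4 0 2 (fun φ => by rw [Fin.sum_univ_five]; ring)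
  have h01 := key 2 3 4 0 1 (fun φ => by rw [Fin.sum_univ_five]; ring)
  rw [sR 0 1 3 2] at h24
  rw [sR 0 1 4 2, sR 0 1 4 3] at h23
  rw [sR 0 2 3 1, sM 0 2 1 3] at h14
  rw [sR 0 2 4 1, sM 0 2 1 4, sR 0 2 4 3] at h13
  rw [sR 0 3 4 1, sM 0 3 1 4, sR 0 3 4 2, sM 0 3 2 4] at h12
  rw [sR 1 2 3 0, sM 1 2 0 3, sL 1 0 2 3] at h04
  rw [sR 1 2 4 0, sM 1 2 0 4, sL 1 0 2 4, sR 1 2 4 3] at h03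
  rw [sR 1 3 4 0, sM 1 3 0 4, sL 1 0 3 4, sR 1 3 4 2, sM 1 3 2 4] at h02
  rw [sR 2 3 4 0, sM 2 3 0 4, sL 2 0 3 4, sR 2 3 4 1, sM 2 3 1 4, sL 2 1 3 4] at h01
  -- In terms of the dual vector, the vanishing of the contraction of `Z` with `F` says that `E` ∧
  -- `F` = 0.
  have hE : ∀ q s, E q * F s = E s * F q := by
    have p01 : Z 1 2 3 4 * F 1 = -Z 0 2 3 4 * F 0 := by linear_combination -h01
    have p02 : Z 1 2 3 4 * F 2 = Z 0 1 3 4 * F 0 := by linear_combination h02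
    have p03 : Z 1 2 3 4 * F 3 = -Z 0 1 2 4 * F 0 := by linear_combination -h03
    have p04 : Z 1 2 3 4 * F 4 = Z 0 1 2 3 * F 0 := by linear_combination h04
    have p12 : -Z 0 2 3 4 * F 2 = Z 0 1 3 4 * F 1 := by linear_combination -h12
    have p13 : -Z 0 2 3 4 * F 3 = -Z 0 1 2 4 * F 1 := by linear_combination h13
    have p14 : -Z 0 2 3 4 * F 4 = Z 0 1 2 3 * F 1 := by linear_combination -h14
    have p23 : Z 0 1 3 4 * F 3 = -Z 0 1 2 4 * F 2 := by linear_combination -h23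
    have p24 : Z 0 1 3 4 * F 4 = Z 0 1 2 3 * F 2 := by linear_combination h24
    have p34 : -Z 0 1 2 4 * F 4 = Z 0 1 2 3 * F 3 := by linear_combination -h34
    have hlt : ∀ q s, q < s → E q * F s = E s * F q := by
      have hcases : ∀ q s : Fin 5, q < s → (q = 0 ∧ s = 1) ∨ (q = 0 ∧ s = 2) ∨ (q = 0 ∧ s = 3) ∨
          (q = 0 ∧ s = 4) ∨ (q = 1 ∧ s = 2) ∨ (q = 1 ∧ s = 3) ∨ (q = 1 ∧ s = 4) ∨
          (q = 2 ∧ s = 3) ∨ (q = 2 ∧ s = 4) ∨ (q = 3 ∧ s = 4) := by omega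
      intro q s hqs
      rcases hcases q s hqs with ⟨rfl, rfl⟩ | ⟨rfl, rfl⟩ | ⟨rfl, rfl⟩ | ⟨rfl, rfl⟩ | ⟨rfl, rfl⟩ |
        ⟨rfl, rfl⟩ | ⟨rfl, rfl⟩ | ⟨rfl, rfl⟩ | ⟨rfl, rfl⟩ | ⟨rfl, rfl⟩
      exacts [p01, p02, p03, p04, p12, p13, p14, p23, p24, p34]
    intro q s
    rcases lt_trichotomy q s with h | rfl | h
    · exact hlt q s h
    · rfl
    · exact (hlt s q h).symm
  -- A nonzero entry of `E` would carry the independence of `F` over to `E`, giving five independent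
  -- elements in the four-dimensional space of linear forms.
  have hE0 : ∀ s, E s = 0 := by
    by_contra! hne
    obtain ⟨s, hs⟩ := hne
    have hind : LinearIndependent K
        (fun q => (⟨E q, hEl q⟩ : homogeneousSubmodule (Fin 4) K 1)) := by
      rw [Fintype.linearIndependent_iff] at hF ⊢
      intro α hα
      have hα' : ∑ q, α q • E q = 0 := by
        simpa using congrArg Subtype.val hα
      refine hF α ((mul_eq_zero.1 ?_).resolve_left hs)
      calc E s * ∑ q, α q • F q = (∑ q, α q • E q) * F s := by
            rw [Finset.mul_sum, Finset.sum_mul]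
            refine Finset.sum_congr rfl fun q _ => ?_
            rw [mul_smul_comm, smul_mul_assoc, hE]
        _ = 0 := by rw [hα', zero_mul]
    have := hind.fintype_card_le_finrank
    rw [finrank_homogeneousSubmodule] at this
    simp at this
  have e0 : Z 1 2 3 4 = 0 := hE0 0
  have e1 : Z 0 2 3 4 = 0 := neg_eq_zero.1 (hE0 1)
  have e2 : Z 0 1 3 4 = 0 := hE0 2
  have e3 : Z 0 1 2 4 = 0 := neg_eq_zero.1 (hE0 3)
  have e4 : Z 0 1 2 3 = 0 := hE0 4
  have hcases : ∀ j p r q : Fin 5, j < p → p < r → r < q →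
      (j = 1 ∧ p = 2 ∧ r = 3 ∧ q = 4) ∨ (j = 0 ∧ p = 2 ∧ r = 3 ∧ q = 4) ∨
      (j = 0 ∧ p = 1 ∧ r = 3 ∧ q = 4) ∨ (j = 0 ∧ p = 1 ∧ r = 2 ∧ q = 4) ∨
      (j = 0 ∧ p = 1 ∧ r = 2 ∧ q = 3) := by omega
  rcases hcases j p r q hjp hpr hrq with ⟨rfl, rfl, rfl, rfl⟩ | ⟨rfl, rfl, rfl, rfl⟩ |
    ⟨rfl, rfl, rfl, rfl⟩ | ⟨rfl, rfl, rfl, rfl⟩ | ⟨rfl, rfl, rfl, rfl⟩ <;> assumption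

end LinearSyzygies

/-! ### Three linear syzygies in four variables -/

section LinearSyzygies

variable {K : Type*} [Field K]

theorem mem_and_mem_of_combinations {A : Type*} [CommRing A] [Algebra K A] (J : Ideal A)
    {x y x' y' : K} {p q : A} (h : x • p + y • q ∈ J) (h' : x' • p + y' • q ∈ J)
    (hdet : x * y' - x' * y ≠ 0) : p ∈ J ∧ q ∈ J := by
  have hs : ∀ (t : K) {z : A}, z ∈ J → t • z ∈ J := fun t z hz => by
    rw [Algebra.smul_def]; exact J.mul_mem_left _ hz
  constructor
  · have := hs (x * y' - x' * y)⁻¹ (J.sub_mem (hs y' h) (hs y h'))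
    convert this using 1
    match_scalars <;> first | ring1 | field_simp
  · have := hs (x * y' - x' * y)⁻¹ (J.sub_mem (hs x h') (hs x' h))
    convert this using 1
    match_scalars <;> first | ring1 | field_simp

/-- The coefficients `v p r q` vanish when an index occurring in the independent part of `c` is
missing from `{p, r, q}`. -/
theorem IsTrivector.apply_eq_zero {F c a : Fin 5 → MvPolynomial (Fin 4) K}
    {v : Fin 5 → Fin 5 → Fin 5 → K} {rk : ℕ} (hF : LinearIndependent K F)
    (hcl : ∀ j, (c j).IsHomogeneous 1) (hv : IsTrivector v) (hc : ∑ j, c j * F j = 0)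
    (hM : ∀ j p, c j * a p - c p * a j = ∑ q, v j p q • F q)
    (hind : ∀ α : Fin 5 → K, ∑ j, α j • c j = 0 → ∀ j : Fin 5, j < rk → α j = 0)
    {i : Fin 5} (hi : i < rk) {p r q : Fin 5} (hp : i ≠ p) (hr : i ≠ r) (hq : i ≠ q) :
    v p r q = 0 := by
  have hlt : ∀ p r q, i ≠ p → i ≠ r → i ≠ q → p < r → r < q → v p r q = 0 := by
    intro p r q hp hr hq hpr hrq
    have hZ : wedgeTrivector c v i p r q = 0 := by
      have key := fun {j p r q} => wedgeTrivector_eq_zero (j := j) (p := p) (r := r) (q := q)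
        hF hcl hv hc hM
      have sR := wedgeTrivector_swap_right (c := c) hv
      have sM := wedgeTrivector_swap_middle (c := c) hv
      have sL := wedgeTrivector_swap_left (c := c) hv
      rcases lt_or_gt_of_ne hp with h | h
      · exact key h hpr hrq
      rw [sL]
      rcases lt_or_gt_of_ne hr with h' | h'
      · rw [key h h' hrq, neg_zero]
      rw [sM]
      rcases lt_or_gt_of_ne hq with h'' | h''
      · rw [key hpr h' h'', neg_zero, neg_zero]
      · rw [sR, key hpr hrq h'', neg_zero, neg_zero, neg_zero]
    -- The vanishing 4-vector coordinate is a scalar relation among the entries of `c`, in which `c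
    -- i` has coefficient `v p r q`.
    have := hind (Pi.single i (v p r q) - Pi.single p (v i r q) + Pi.single r (v i p q) -
      Pi.single q (v i p r)) (by
        rw [← hZ]
        simp [wedgeTrivector, sub_smul, add_smul, Finset.sum_add_distrib, Pi.single_apply]) i hi
    simpa [hp, hr, hq] using this
  have h3 : ∀ p r q, i ≠ p → i ≠ r → i ≠ q → p < r → v p r q = 0 := by
    intro p r q hp hr hq hpr
    rcases lt_trichotomy r q with h | rfl | h
    · exact hlt p r q hp hr hq hpr h
    · exact hv.zero_right _ _
    rw [hv.swap_right]
    rcases lt_trichotomy p q with h' | rfl | h'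
    · rw [hlt p q r hp hq hr h' h, neg_zero]
    · rw [hv.zero_left, neg_zero]
    · rw [hv.swap_left, hlt q p r hq hp hr h' hpr, neg_zero, neg_zero]
  rcases lt_trichotomy p r with h | rfl | h
  · exact h3 p r q hp hr hq h
  · exact hv.zero_left _ _
  · rw [hv.swap_left, h3 r p q hr hp hq h, neg_zero]

/-- Three linear relations on five independent forms in four variables, whose pairwise exterior
products are contractions of trivectors: all but one of the forms lie in an ideal generated by two
linear forms. -/
theorem exists_mem_span_of_three_relations {F : Fin 5 → MvPolynomial (Fin 4) K}
    {a : Fin 3 → Fin 5 → MvPolynomial (Fin 4) K} (hF : LinearIndependent K F)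
    (hal : ∀ i j, (a i j).IsHomogeneous 1) (hrel : ∀ i, ∑ j, a i j * F j = 0)
    (ha : LinearIndependent K a)
    (hv : ∀ i, ∃ v : Fin 5 → Fin 5 → Fin 5 → K, IsTrivector v ∧
      ∀ j p, a 0 j * a i p - a 0 p * a i j = ∑ q, v j p q • F q)
    {rk : ℕ} (hzero : ∀ j : Fin 5, rk ≤ j → a 0 j = 0)
    (hind : ∀ α : Fin 5 → K, ∑ j, α j • a 0 j = 0 → ∀ j : Fin 5, j < rk → α j = 0) :
    ∃ q, ∀ j, F j ∈ Ideal.span {a 0 0, a 0 1, F q} := by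
  obtain ⟨w, hw, hwM⟩ := hv 2
  obtain ⟨v, hv, hvM⟩ := hv 1
  have hne : ∀ j : Fin 5, j < rk → a 0 j ≠ 0 := by
    intro j hj h0
    have := hind (Pi.single j 1) (by simp [Pi.single_apply, h0]) j hj
    simp at this
  -- With at most one nonzero entry, the syzygy would read `a 0 0 * F 0 = 0`.
  have hrk : 2 ≤ rk := by
    by_contra! hlt
    have h1 : ∀ j : Fin 5, j ≠ 0 → a 0 j = 0 := fun j hj => hzero j (by
      have : (j : ℕ) ≠ 0 := fun h => hj (Fin.ext h)
      omega)
    have h2 := hrel 0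
    rw [Finset.sum_eq_single 0 (fun j _ hj => by rw [h1 j hj, zero_mul]) (by simp)] at h2
    have h3 : a 0 0 = 0 := (mul_eq_zero.1 h2).resolve_right (hF.ne_zero 0)
    refine ha.ne_zero 0 (funext fun j => ?_)
    by_cases hj : j = 0
    · rw [hj, h3]; rfl
    · exact h1 j hj
  have h01 : ∀ κ : K, a 0 1 ≠ C κ * a 0 0 := by
    intro κ h
    have := hind (Pi.single 1 1 - Pi.single 0 κ) (by
      simp [Pi.single_apply, sub_smul, h, smul_eq_C_mul]) 1 hrk
    simp at this
  -- no nontrivial combination of the two trivectors vanishes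
  have hN : ∀ s t : K, (∀ j p q, s * v j p q + t * w j p q = 0) → s = 0 ∧ t = 0 := by
    intro s t hst
    have hm : ∀ j p, a 0 j * (s • a 1 p + t • a 2 p) = a 0 p * (s • a 1 j + t • a 2 j) := by
      intro j p
      -- If the combination of trivectors vanishes, then `a 0` has zero exterior product with `s • a
      -- 1 + t • a 2`, which is therefore a scalar multiple of `a 0`.
      have h1 : s • (a 0 j * a 1 p - a 0 p * a 1 j) + t • (a 0 j * a 2 p - a 0 p * a 2 j) = 0 := by
        rw [hvM, hwM, Finset.smul_sum, Finset.smul_sum, ← Finset.sum_add_distrib]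
        refine Finset.sum_eq_zero fun q _ => ?_
        rw [smul_smul, smul_smul, ← add_smul, hst, zero_smul]
      simp only [smul_eq_C_mul] at h1 ⊢
      linear_combination h1
    have hml : ∀ j, (s • a 1 j + t • a 2 j).IsHomogeneous 1 := fun j => by
      simp only [smul_eq_C_mul]
      exact ((hal _ _).C_mul _).add ((hal _ _).C_mul _)
    have h00 : a 0 0 ≠ 0 := hne 0 (by simpa using (by omega : 0 < rk))
    obtain ⟨κ, hκ⟩ := exists_eq_C_mul_of_mul_eq_mul (hal 0 0) (hal 0 1) (hml 0) h01 h00 (hm 0 1)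
    have hall : ∀ p, s • a 1 p + t • a 2 p = C κ * a 0 p := fun p => by
      refine mul_left_cancel₀ h00 ?_
      rw [hm 0 p, hκ]; ring
    have := Fintype.linearIndependent_iff.1 ha ![-κ, s, t] (by
      rw [Fin.sum_univ_three]
      funext p
      have := hall p
      simp only [smul_eq_C_mul, Pi.add_apply, Pi.smul_apply, Matrix.cons_val, Pi.zero_apply,
        map_neg] at this ⊢
      linear_combination this)
    exact ⟨this 1, this 2⟩
  have hv0 := fun {i} hi {p r q} => hv.apply_eq_zero hF (hal 0) (hrel 0) hvM hind
    (i := i) hi (p := p) (r := r) (q := q)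
  have hw0 := fun {i} hi {p r q} => hw.apply_eq_zero hF (hal 0) (hrel 0) hwM hind
    (i := i) hi (p := p) (r := r) (q := q)
  rcases hrk.lt_or_eq with hrk3 | hrk2
  -- Both trivectors are divisible by e_0, e_1 and e_2, hence are multiples of e_0 ∧ e_1 ∧ e_2 and
  -- linearly dependent.
  · exfalso
    have hvan : ∀ s t : K, s * v 0 1 2 + t * w 0 1 2 = 0 → s = 0 ∧ t = 0 := by
      intro s t h
      refine hN s t fun j p q => ?_
      have hcases : ∀ j p q : Fin 5, (∃ i : Fin 5, i < 3 ∧ i ≠ j ∧ i ≠ p ∧ i ≠ q) ∨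
          (j = 0 ∧ p = 1 ∧ q = 2) ∨ (j = 0 ∧ p = 2 ∧ q = 1) ∨ (j = 1 ∧ p = 0 ∧ q = 2) ∨
          (j = 1 ∧ p = 2 ∧ q = 0) ∨ (j = 2 ∧ p = 0 ∧ q = 1) ∨ (j = 2 ∧ p = 1 ∧ q = 0) := by
        decide
      rcases hcases j p q with ⟨i, hi, h1, h2, h3⟩ | ⟨rfl, rfl, rfl⟩ | ⟨rfl, rfl, rfl⟩ |
        ⟨rfl, rfl, rfl⟩ | ⟨rfl, rfl, rfl⟩ | ⟨rfl, rfl, rfl⟩ | ⟨rfl, rfl, rfl⟩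
      · have hi' : (i : ℕ) < rk := by
          have : (i : ℕ) < 3 := hi
          omega
        rw [hv0 hi' h1 h2 h3, hw0 hi' h1 h2 h3]; ring
      · exact h
      · rw [hv.swap_right, hw.swap_right]; linear_combination -h
      · rw [hv.swap_left, hw.swap_left]; linear_combination -h
      · rw [hv.swap_right, hw.swap_right, hv.swap_left, hw.swap_left]; linear_combination h
      · rw [hv.swap_left, hw.swap_left, hv.swap_right, hw.swap_right]; linear_combination h
      · rw [hv.swap_right, hw.swap_right, hv.swap_left, hw.swap_left, hv.swap_right,
          hw.swap_right]
        linear_combination -h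
    obtain ⟨h1, h2⟩ := hvan (w 0 1 2) (- v 0 1 2) (by ring)
    exact one_ne_zero (hvan 1 0 (by rw [neg_eq_zero.1 h2]; ring)).1
  · subst hrk2
    have hz : ∀ p : Fin 5, 2 ≤ p → a 0 p = 0 := fun p hp => hzero p hp
    have ne0 : ∀ p : Fin 5, 2 ≤ p → (0 : Fin 5) ≠ p := by decide
    have ne1 : ∀ p : Fin 5, 2 ≤ p → (1 : Fin 5) ≠ p := by decide
    -- the trivectors are determined by the coefficients `v 0 1 q`
    have hNq : ∀ s t : K, (∀ q : Fin 5, 2 ≤ q → s * v 0 1 q + t * w 0 1 q = 0) →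
        s = 0 ∧ t = 0 := by
      intro s t h
      refine hN s t fun j p q => ?_
      have hcases : ∀ j p q : Fin 5, (∃ i : Fin 5, i < 2 ∧ i ≠ j ∧ i ≠ p ∧ i ≠ q) ∨
          j = p ∨ p = q ∨ j = q ∨
          (j = 0 ∧ p = 1 ∧ 2 ≤ q) ∨ (j = 0 ∧ 2 ≤ p ∧ q = 1) ∨ (j = 1 ∧ p = 0 ∧ 2 ≤ q) ∨
          (j = 1 ∧ 2 ≤ p ∧ q = 0) ∨ (2 ≤ j ∧ p = 0 ∧ q = 1) ∨ (2 ≤ j ∧ p = 1 ∧ q = 0) := by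
        decide
      rcases hcases j p q with ⟨i, hi, h1, h2, h3⟩ | rfl | rfl | rfl | ⟨rfl, rfl, hq⟩ |
        ⟨rfl, hq, rfl⟩ |
        ⟨rfl, rfl, hq⟩ | ⟨rfl, hq, rfl⟩ | ⟨hq, rfl, rfl⟩ | ⟨hq, rfl, rfl⟩
      · rw [hv0 hi h1 h2 h3, hw0 hi h1 h2 h3]; ring
      · rw [hv.zero_left, hw.zero_left]; ring
      · rw [hv.zero_right, hw.zero_right]; ring
      · rw [hv.zero_outer, hw.zero_outer]; ring
      · exact h _ hq
      · rw [hv.swap_right, hw.swap_right]; linear_combination -h _ hq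
      · rw [hv.swap_left, hw.swap_left]; linear_combination -h _ hq
      · rw [hv.swap_right, hw.swap_right, hv.swap_left, hw.swap_left]; linear_combination h _ hq
      · rw [hv.swap_left, hw.swap_left, hv.swap_right, hw.swap_right]; linear_combination h _ hq
      · rw [hv.swap_right, hw.swap_right, hv.swap_left, hw.swap_left, hv.swap_right,
          hw.swap_right]
        linear_combination -h _ hq
    obtain ⟨p, hp, hvp⟩ : ∃ p : Fin 5, 2 ≤ p ∧ v 0 1 p ≠ 0 := by
      by_contra! h
      exact one_ne_zero (hNq 1 0 (fun q hq => by rw [h q hq]; ring)).1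
    set J : Ideal (MvPolynomial (Fin 4) K) := Ideal.span {a 0 0, a 0 1} with hJ
    have hJ0 : a 0 0 ∈ J := Ideal.subset_span (by simp)
    have hJ1 : a 0 1 ∈ J := Ideal.subset_span (by simp)
    have hunit : ∀ {x : K} {y : MvPolynomial (Fin 4) K}, x ≠ 0 → x • y ∈ J → y ∈ J := by
      intro x y hx h
      have := J.mul_mem_left (C x⁻¹) h
      rwa [← smul_eq_C_mul, smul_smul, inv_mul_cancel₀ hx, one_smul] at this
    -- In the entry (0, p) of the exterior product the term with `a 0 p` is zero, and the
    -- contraction reduces to its `F 1` term.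
    have hF1 : F 1 ∈ J := by
      refine hunit (neg_ne_zero.2 hvp) ?_
      have h1 := hvM 0 p
      rw [hz p hp, zero_mul, sub_zero, Finset.sum_eq_single 1 (fun q _ hq => by
        rw [hv0 (i := 1) (by decide) (by decide) (ne1 p hp) hq.symm, zero_smul]) (by simp),
        hv.swap_right] at h1
      rw [← h1]
      exact J.mul_mem_right _ hJ0
    have hF0 : F 0 ∈ J := by
      refine hunit hvp ?_
      have h1 := hvM 1 p
      rw [hz p hp, zero_mul, sub_zero, Finset.sum_eq_single 0 (fun q _ hq => by
        rw [hv0 (i := 0) (by decide) (by decide) (ne0 p hp) hq.symm, zero_smul]) (by simp),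
        hv.swap_right, hv.swap_left, neg_neg] at h1
      rw [← h1]
      exact J.mul_mem_right _ hJ1
    -- The entry (0, 1) of each exterior product puts a combination of `F 2`, `F 3`, `F 4` in `J`.
    have hsum : ∀ {u : Fin 5 → Fin 5 → Fin 5 → K} {b : Fin 5 → MvPolynomial (Fin 4) K},
        IsTrivector u → (∀ j p, a 0 j * b p - a 0 p * b j = ∑ q, u j p q • F q) →
        u 0 1 2 • F 2 + u 0 1 3 • F 3 + u 0 1 4 • F 4 ∈ J := by
      intro u b hu huM
      have h1 := huM 0 1
      rw [Fin.sum_univ_five, hu.zero_outer, hu.zero_right, zero_smul, zero_smul, zero_add,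
        zero_add] at h1
      rw [← h1]
      exact J.sub_mem (J.mul_mem_right _ hJ0) (J.mul_mem_right _ hJ1)
    have hsv := hsum hv hvM
    have hsw := hsum hw hwM
    have hspan : ∀ q, Ideal.span {a 0 0, a 0 1, F q} = J ⊔ Ideal.span {F q} := by
      intro q
      rw [hJ, ← Ideal.span_union]
      congr 1
      ext; simp; tauto
    have hle : ∀ q, J ≤ J ⊔ Ideal.span {F q} := fun q => le_sup_left
    have hself : ∀ q, F q ∈ J ⊔ Ideal.span {F q} := fun q =>
      Ideal.mem_sup_right (Ideal.mem_span_singleton_self _)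
    have hsm : ∀ (t : K) q, t • F q ∈ J ⊔ Ideal.span {F q} := fun t q => by
      rw [smul_eq_C_mul]; exact Ideal.mul_mem_left _ _ (hself q)
    have hfin : ∀ q, (F 2 ∈ J ⊔ Ideal.span {F q}) → (F 3 ∈ J ⊔ Ideal.span {F q}) →
        (F 4 ∈ J ⊔ Ideal.span {F q}) → ∃ q, ∀ j, F j ∈ Ideal.span {a 0 0, a 0 1, F q} := by
      intro q h2 h3 h4
      refine ⟨q, fun j => ?_⟩
      rw [hspan]
      fin_cases j
      exacts [hle q hF0, hle q hF1, h2, h3, h4]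
    -- A nonzero 2×2 minor of the two coefficient rows solves for two of `F 2`, `F 3`, `F 4` modulo
    -- `J` and the third. If all minors vanish, the rows are dependent, contrary to `hNq`.
    by_cases h23 : v 0 1 2 * w 0 1 3 - w 0 1 2 * v 0 1 3 ≠ 0
    · obtain ⟨h1, h2⟩ := mem_and_mem_of_combinations (J ⊔ Ideal.span {F 4})
        (((Ideal.add_mem_iff_left _ (hsm _ 4)).1 (hle 4 hsv)))
        (((Ideal.add_mem_iff_left _ (hsm _ 4)).1 (hle 4 hsw))) h23
      exact hfin 4 h1 h2 (hself 4)
    by_cases h24 : v 0 1 2 * w 0 1 4 - w 0 1 2 * v 0 1 4 ≠ 0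
    · rw [add_right_comm] at hsv hsw
      obtain ⟨h1, h2⟩ := mem_and_mem_of_combinations (J ⊔ Ideal.span {F 3})
        (((Ideal.add_mem_iff_left _ (hsm _ 3)).1 (hle 3 hsv)))
        (((Ideal.add_mem_iff_left _ (hsm _ 3)).1 (hle 3 hsw))) h24
      exact hfin 3 h1 (hself 3) h2
    by_cases h34 : v 0 1 3 * w 0 1 4 - w 0 1 3 * v 0 1 4 ≠ 0
    · rw [add_assoc, add_comm] at hsv hsw
      obtain ⟨h1, h2⟩ := mem_and_mem_of_combinations (J ⊔ Ideal.span {F 2})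
        (((Ideal.add_mem_iff_left _ (hsm _ 2)).1 (hle 2 hsv)))
        (((Ideal.add_mem_iff_left _ (hsm _ 2)).1 (hle 2 hsw))) h34
      exact hfin 2 (hself 2) h1 h2
    exfalso
    rw [not_not] at h23 h24 h34
    have hq2 : ∀ q : Fin 5, 2 ≤ q → q = 2 ∨ q = 3 ∨ q = 4 := by decide
    have := hNq (w 0 1 p) (- v 0 1 p) (fun q hq => by
      rcases hq2 p hp with rfl | rfl | rfl <;> rcases hq2 q hq with rfl | rfl | rfl <;>
        first
        | ring1
        | linear_combination h23
        | linear_combination h24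
        | linear_combination h34
        | linear_combination -h23
        | linear_combination -h24
        | linear_combination -h34)
    exact hvp (neg_eq_zero.1 this.2)

end LinearSyzygies

/-! ### A multiple of L in the span of the regular sequence -/

section LinearFactor

variable {K : Type*} [Field K]

theorem span_ne_top_of_isHomogeneous {σ : Type*} {s : Set (MvPolynomial σ K)}
    (hs : ∀ x ∈ s, ∃ d, 0 < d ∧ x.IsHomogeneous d) : Ideal.span s ≠ ⊤ := by
  intro h
  have hle : Ideal.span s ≤ RingHom.ker (constantCoeff : MvPolynomial σ K →+* K) := by
    rw [Ideal.span_le]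
    intro x hx
    obtain ⟨d, hd, hxd⟩ := hs x hx
    rw [SetLike.mem_coe, RingHom.mem_ker, constantCoeff_eq]
    exact hxd.coeff_eq_zero (by simpa using hd.ne)
  rw [h] at hle
  have := hle (Submodule.mem_top (x := 1))
  simp [RingHom.mem_ker] at this

/-- A regular sequence is not contained in an ideal generated by fewer forms. -/
theorem IsSequentiallyRegular.exists_notMem {n m : ℕ} {f : Fin n → MvPolynomial (Fin m) K}
    (hf : IsSequentiallyRegular f) (s : Set (MvPolynomial (Fin m) K)) (hfin : s.Finite)
    (hcard : s.ncard < n) (hs : ∀ x ∈ s, ∃ d, 0 < d ∧ x.IsHomogeneous d) :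
    ∃ j, f j ∉ Ideal.span s := by
  by_contra! h
  exact span_ne_top_of_isHomogeneous hs (hf.span_eq_top_of_le s hfin hcard h)

theorem exists_homogeneous_of_dvd {σ : Type*} {m d : ℕ} {L p : MvPolynomial σ K}
    (hL : L.IsHomogeneous m) (hp : p.IsHomogeneous (d + m)) (h : L ∣ p) :
    ∃ M, M.IsHomogeneous d ∧ p = L * M := by
  obtain ⟨M, rfl⟩ := h
  refine ⟨homogeneousComponent d M, homogeneousComponent_isHomogeneous _ _, ?_⟩
  rw [mul_comm L, mul_comm L, ← homogeneousComponent_mul_of_isHomogeneous d M hL,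
    homogeneousComponent_eq_self (by rwa [mul_comm])]

/-- The exterior product of two relations modulo `L` among quadrics is, modulo `L`, the contraction
of a trivector. -/
theorem KoszulExact.exists_trivector {σ ι : Type*} [Fintype ι] {f : ι → MvPolynomial σ K}
    (hk : KoszulExact f) (hf : ∀ j, (f j).IsHomogeneous 2) (hfi : LinearIndependent K f)
    {L g g' : MvPolynomial σ K} (hL : L.IsHomogeneous 1) (hg : g.IsHomogeneous 2)
    (hg' : g'.IsHomogeneous 2) {l l' : ι → MvPolynomial σ K} (hl : ∀ j, (l j).IsHomogeneous 1)
    (hl' : ∀ j, (l' j).IsHomogeneous 1) (h : L * g = ∑ j, l j * f j)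
    (h' : L * g' = ∑ j, l' j * f j) :
    ∃ v : ι → ι → ι → K, IsTrivector v ∧ ∃ e : ι → ι → MvPolynomial σ K,
      ∀ j p, l j * l' p - l p * l' j - L * e j p = ∑ q, v j p q • f q := by
  -- Expanding L g g' in two ways gives a first relation on `f`; its Koszul coefficients `u` are
  -- linear.
  obtain ⟨u, hu, hb⟩ := hk.exists_homogeneous (d := 1) hf
    (b := fun j => l j * g' - l' j * g) (fun j => ((hl j).mul hg').sub ((hl' j).mul hg)) (by
      have : ∑ j, (l j * g' - l' j * g) * f j =
          g' * ∑ j, l j * f j - g * ∑ j, l' j * f j := by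
        rw [Finset.mul_sum, Finset.mul_sum, ← Finset.sum_sub_distrib]
        exact Finset.sum_congr rfl fun j _ => by ring
      rw [this, ← h, ← h']; ring)
  -- Substituting them back gives, for each `j`, a second relation. Its coefficients are quadrics,
  -- so its Koszul coefficients are scalars, antisymmetric in the last two indices.
  have hrel : ∀ j, ∑ p, (l j * l' p - l p * l' j - L * (u j p - u p j)) * f p = 0 := by
    intro j
    have : ∑ p, (l j * l' p - l p * l' j - L * (u j p - u p j)) * f p =
        l j * ∑ p, l' p * f p - l' j * ∑ p, l p * f p - L * ∑ p, (u j p - u p j) * f p := by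
      simp only [Finset.mul_sum, ← Finset.sum_sub_distrib]
      exact Finset.sum_congr rfl fun j _ => by ring
    rw [this, ← h, ← h', ← hb]; ring
  have := fun j => hk.exists_scalar hf (fun p => (((hl j).mul (hl' p)).sub
    ((hl p).mul (hl' j))).sub (hL.mul ((hu j p).sub (hu p j)))) (hrel j)
  choose t ht using this
  have hvt : ∀ j p, l j * l' p - l p * l' j - L * (u j p - u p j) =
      ∑ q, (t j p q - t j q p) • f q := fun j p => by
    rw [ht]
    simp only [smul_eq_C_mul]
  -- The left side of `hvt` alternates in `j`, `p`; independence of `f` transfers this to the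
  -- scalars. The zero diagonal is proved separately, so characteristic two is covered.
  rw [Fintype.linearIndependent_iff] at hfi
  refine ⟨fun j p q => t j p q - t j q p, ⟨fun j => ?_, fun j q => by ring, fun j p => ?_,
    fun j p q => by ring⟩, fun j p => u j p - u p j, hvt⟩
  · refine hfi (fun q => t j j q - t j q j) ?_
    rw [← hvt]; ring
  · have := hfi (fun q => (t j p q - t j q p) + (t p j q - t p q j)) (by
      simp only [add_smul, Finset.sum_add_distrib, ← hvt]; ring)
    exact fun q => eq_neg_of_add_eq_zero_left (this q)

/-- A linear form annihilating three quadrics modulo a regular sequence `f` of five quadrics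
divides an element of the span of `f`. -/
theorem exists_linear_multiple_mem_span {f : Fin 5 → MvPolynomial (Fin 5) K}
    {g : Fin 3 → MvPolynomial (Fin 5) K} (hreg : IsSequentiallyRegular f)
    (hf : ∀ j, (f j).IsHomogeneous 2) (hg : ∀ i, (g i).IsHomogeneous 2)
    (hfg : LinearIndependent K (Sum.elim f g)) {L : MvPolynomial (Fin 5) K}
    (hL : L.IsHomogeneous 1) (hL0 : L ≠ 0)
    (hLg : ∀ i, L * g i ∈ Ideal.span (Set.range f)) :
    ∃ M, M.IsHomogeneous 1 ∧ M ≠ 0 ∧ ∃ α : Fin 5 → K, L * M = ∑ j, C (α j) * f j := by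
  by_contra! hM
  have hfi : LinearIndependent K f := by
    simpa [Function.comp_def] using hfg.comp Sum.inl Sum.inl_injective
  have := fun i => exists_homogeneous_coeff (d := 1) hf (hL.mul (hg i)) (hLg i)
  choose l hl hlg using this
  obtain ⟨π, hπs, hπh, hπk⟩ := exists_projection hL hL0
  have hπd : ∀ p, π p = 0 → L ∣ p := fun p hp => by
    rw [← Ideal.mem_span_singleton, ← hπk, RingHom.mem_ker]; exact hp
  have hπL : π L = 0 := by
    have : L ∈ RingHom.ker π := by rw [hπk]; exact Ideal.mem_span_singleton_self L
    exact this
  -- Change of generators of the span of `f` adapted to the first syzygy modulo `L`.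
  obtain ⟨B, rk, hB0, hBi⟩ := exists_adapted_basis (Module.finrank_fin_fun K)
    (Fintype.linearCombination K fun j => π (l 0 j))
  set P : Matrix (Fin 5) (Fin 5) K := (Pi.basisFun K (Fin 5)).toMatrix B with hP
  set Q : Matrix (Fin 5) (Fin 5) K := B.toMatrix (Pi.basisFun K (Fin 5)) with hQ
  have hPQ : P * Q = 1 := (Pi.basisFun K (Fin 5)).toMatrix_mul_toMatrix_flip B
  have hQP : Q * P = 1 := B.toMatrix_mul_toMatrix_flip (Pi.basisFun K (Fin 5))
  set P' : Matrix (Fin 5) (Fin 5) (MvPolynomial (Fin 5) K) := P.map C with hP'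
  set Q' : Matrix (Fin 5) (Fin 5) (MvPolynomial (Fin 5) K) := Q.map C with hQ'
  have hPQ' : P' * Q' = 1 := by rw [hP', hQ', ← Matrix.map_mul, hPQ, Matrix.map_one _ C_0 C_1]
  have hQP' : Q' * P' = 1 := by rw [hP', hQ', ← Matrix.map_mul, hQP, Matrix.map_one _ C_0 C_1]
  set f' := Q' *ᵥ f with hf'
  have hff' : f = P' *ᵥ f' := by rw [hf', mulVec_mulVec, hPQ', one_mulVec]
  have hf'2 : ∀ j, (f' j).IsHomogeneous 2 := fun j =>
    IsHomogeneous.sum _ _ _ fun k _ => by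
      simpa [hQ'] using (hf k).C_mul (Q j k)
  have hk' : KoszulExact f' := hreg.koszulExact.of_eq_mulVec Q' P' hQP' hf' hff'
  have hf'mem : ∀ j, f' j ∈ Ideal.span (Set.range f) := fun j => by
    rw [hf', mulVec, dotProduct]
    exact Ideal.sum_mem _ fun k _ =>
      Ideal.mul_mem_left _ _ (Ideal.subset_span (Set.mem_range_self k))
  have hcomb : ∀ α : Fin 5 → K, ∑ j, C (α j) * f' j = ∑ k, C ((α ᵥ* Q) k) * f k := by
    intro α
    have : (fun j => C (α j)) ⬝ᵥ (Q' *ᵥ f) = ((fun j => C (α j)) ᵥ* Q') ⬝ᵥ f :=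
      dotProduct_mulVec _ _ _
    simpa [dotProduct, vecMul, hQ', hf', map_sum] using this
  have hα0 : ∀ α : Fin 5 → K, α ᵥ* Q = 0 → α = 0 := fun α h => by
    rw [← vecMul_one α, ← hQP, ← vecMul_vecMul, h, zero_vecMul]
  have hf'i : LinearIndependent K f' := by
    rw [Fintype.linearIndependent_iff] at hfi ⊢
    intro α hα
    simp only [smul_eq_C_mul] at hα hfi
    rw [hcomb] at hα
    exact congrFun (hα0 α (funext (hfi _ hα)))
  -- A dependency modulo `L` would be a multiple L M in the span of `f`, excluded by `hM`.
  have hF : LinearIndependent K fun j => π (f' j) := by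
    rw [Fintype.linearIndependent_iff]
    intro α hα
    have h1 : π (∑ j, C (α j) * f' j) = 0 := by
      simpa [smul_eq_C_mul, map_sum, algHom_C] using hα
    obtain ⟨M, hM1, hM2⟩ := exists_homogeneous_of_dvd (d := 1) hL
      (IsHomogeneous.sum _ _ _ fun j _ => (hf'2 j).C_mul (α j)) (hπd _ h1)
    have hM0 : M = 0 := by
      by_contra hne
      exact hM M hM1 hne (α ᵥ* Q) (by rw [← hM2, hcomb])
    rw [hM0, mul_zero] at hM2
    rw [Fintype.linearIndependent_iff] at hf'i
    exact hf'i α (by simpa [smul_eq_C_mul] using hM2)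
  set l' : Fin 3 → Fin 5 → MvPolynomial (Fin 5) K := fun i => l i ᵥ* P' with hl'
  have hl'h : ∀ i j, (l' i j).IsHomogeneous 1 := fun i j =>
    IsHomogeneous.sum _ _ _ fun k _ => by
      simpa [hP', mul_comm] using (hl i k).C_mul (P k j)
  have hl'g : ∀ i, L * g i = ∑ j, l' i j * f' j := fun i => by
    have : l i ⬝ᵥ (P' *ᵥ f') = (l i ᵥ* P') ⬝ᵥ f' := dotProduct_mulVec _ _ _
    rw [← hff'] at this
    rw [hlg]
    exact this
  have ha0 : ∀ j, π (l' 0 j) = Fintype.linearCombination K (fun j => π (l 0 j)) (B j) := by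
    intro j
    simp [hl', vecMul, dotProduct, hP', hP, Module.Basis.toMatrix_apply,
      Fintype.linearCombination_apply, smul_eq_C_mul, algHom_C, mul_comm]
  -- If a combination of the syzygies vanishes modulo `L`, cancelling `L` puts the same combination
  -- of the `g i` in the ideal of `f`.
  have ha : LinearIndependent K fun i j => π (l' i j) := by
    rw [Fintype.linearIndependent_iff]
    intro c hc
    have hd : ∀ j, L ∣ ∑ i, C (c i) * l' i j := fun j => by
      refine hπd _ ?_
      have := congrFun hc j
      simpa [smul_eq_C_mul, algHom_C] using this
    choose d hd using hd
    have h1 : ∑ i, C (c i) * g i = ∑ j, d j * f' j := by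
      refine mul_left_cancel₀ hL0 ?_
      calc L * ∑ i, C (c i) * g i = ∑ i, C (c i) * (L * g i) := by
            rw [Finset.mul_sum]; exact Finset.sum_congr rfl fun i _ => by ring
        _ = ∑ j, (∑ i, C (c i) * l' i j) * f' j := by
            simp only [hl'g, Finset.mul_sum, Finset.sum_mul]
            rw [Finset.sum_comm]
            exact Finset.sum_congr rfl fun j _ => Finset.sum_congr rfl fun i _ => by ring
        _ = L * ∑ j, d j * f' j := by
            rw [Finset.mul_sum]
            exact Finset.sum_congr rfl fun j _ => by rw [hd]; ring
    have h2 : ∑ i, C (c i) * g i ∈ Ideal.span (Set.range f) := by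
      rw [h1]
      exact Ideal.sum_mem _ fun j _ => Ideal.mul_mem_left _ _ (hf'mem j)
    obtain ⟨d', hd'⟩ := exists_scalar_coeff hf
      (IsHomogeneous.sum _ _ _ fun i _ => (hg i).C_mul (c i)) h2
    rw [Fintype.linearIndependent_iff] at hfg
    have := hfg (Sum.elim (fun j => - d' j) c) (by
      simp [smul_eq_C_mul, hd'])
    exact fun i => this (Sum.inr i)
  obtain ⟨q, hq⟩ := exists_mem_span_of_three_relations (a := fun i j => π (l' i j)) hF
    (fun i j => hπh _ _ (hl'h i j))
    (fun i => by
      have := congrArg π (hl'g i)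
      rw [map_mul, hπL, zero_mul, map_sum] at this
      simpa using this.symm)
    ha
    (fun i => by
      obtain ⟨v, hv, e, he⟩ := hk'.exists_trivector hf'2 hf'i hL (hg 0) (hg i) (hl'h 0) (hl'h i)
        (hl'g 0) (hl'g i)
      refine ⟨v, hv, fun j p => ?_⟩
      have := congrArg π (he j p)
      simpa [hπL] using this)
    (rk := rk) (fun j hj => by rw [ha0]; exact hB0 j hj)
    (fun α hα => hBi α (by simpa only [ha0] using hα))
  -- Four forms of positive degree cannot generate an ideal containing all five `f k`.
  obtain ⟨k, hk⟩ := hreg.exists_notMem {L, l' 0 0, l' 0 1, f' q} (Set.toFinite _)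
    ((Set.ncard_insert_le _ _).trans_lt (by
      have := Set.ncard_insert_le (l' 0 0) {l' 0 1, f' q}
      have := Set.ncard_insert_le (l' 0 1) {f' q}
      rw [Set.ncard_singleton] at this
      omega))
    (by
      rintro x (rfl | rfl | rfl | rfl)
      exacts [⟨1, one_pos, hL⟩, ⟨1, one_pos, hl'h 0 0⟩, ⟨1, one_pos, hl'h 0 1⟩,
        ⟨2, two_pos, hf'2 q⟩])
  have hmem : ∀ j, f' j ∈ Ideal.span {L, l' 0 0, l' 0 1, f' q} := by
    intro j
    have h1 : π (f' j) ∈ (Ideal.span {l' 0 0, l' 0 1, f' q}).map π := by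
      rw [Ideal.map_span]
      simpa [Set.image_insert_eq] using hq j
    rw [← Ideal.mem_comap, Ideal.comap_map_of_surjective' π hπs, hπk] at h1
    rw [Ideal.span_insert, sup_comm]
    exact h1
  refine hk ?_
  rw [hff', mulVec, dotProduct]
  exact Ideal.sum_mem _ fun j _ => Ideal.mul_mem_left _ _ (hmem j)

end LinearFactor

/-! ### Exchanging a member of a regular sequence -/

section Replacement

variable {A : Type*} [CommRing A] {n : ℕ} {f : Fin n → A} {i : Fin n} {c h : A}

/-- Up to a unit, `h` and `f i` differ by a combination of the preceding terms, so a span is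
unaffected when these terms accompany `f i`. Initial segments and the whole index set both qualify.
-/
theorem span_update_image (hc : IsUnit c)
    (hh : h - c * f i ∈ Ideal.span (f '' Set.Iio i)) {s : Set (Fin n)}
    (hs : i ∈ s → Set.Iio i ⊆ s) :
    Ideal.span (Function.update f i h '' s) = Ideal.span (f '' s) := by
  by_cases his : i ∈ s
  · have hsub := Set.image_mono (f := f) (hs his)
    have hIio : f '' Set.Iio i ⊆ Function.update f i h '' s := by
      rintro _ ⟨j, hj, rfl⟩
      exact ⟨j, hs his hj, Function.update_of_ne (ne_of_lt hj) _ _⟩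
    apply le_antisymm <;> rw [Ideal.span_le] <;> rintro _ ⟨j, hj, rfl⟩ <;> rw [SetLike.mem_coe] <;>
      by_cases hji : j = i
    · subst hji
      rw [Function.update_self, ← sub_add_cancel h (c * f j)]
      exact Ideal.add_mem _ (Ideal.span_mono hsub hh)
        (Ideal.mul_mem_left _ _ (Ideal.subset_span ⟨j, hj, rfl⟩))
    · rw [Function.update_of_ne hji]
      exact Ideal.subset_span ⟨j, hj, rfl⟩
    · subst hji
      have h1 : h ∈ Ideal.span (Function.update f j h '' s) :=
        Ideal.subset_span ⟨j, hj, Function.update_self _ _ _⟩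
      rw [← Ideal.unit_mul_mem_iff_mem _ hc, ← sub_sub_cancel h (c * f j)]
      exact Ideal.sub_mem _ h1 (Ideal.span_mono hIio hh)
    · exact Ideal.subset_span ⟨j, hj, Function.update_of_ne hji _ _⟩
  · congr 1
    refine Set.image_congr fun j hj => Function.update_of_ne ?_ _ _
    rintro rfl
    exact his hj

theorem span_range_update (hc : IsUnit c)
    (hh : h - c * f i ∈ Ideal.span (f '' Set.Iio i)) :
    Ideal.span (Set.range (Function.update f i h)) = Ideal.span (Set.range f) := by
  rw [← Set.image_univ, ← Set.image_univ]
  exact span_update_image hc hh fun _ => Set.subset_univ _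

theorem IsSequentiallyRegular.update (hf : IsSequentiallyRegular f) (hc : IsUnit c)
    (hh : h - c * f i ∈ Ideal.span (f '' Set.Iio i)) :
    IsSequentiallyRegular (Function.update f i h) := by
  intro k u
  rw [span_update_image hc hh fun hi => Set.Iio_subset_Iio (le_of_lt hi)]
  by_cases hk : k = i
  · subst hk
    rw [Function.update_self]
    intro hu
    refine hf k u ((Ideal.unit_mul_mem_iff_mem _ hc).1 ?_)
    have : c * (f k * u) = h * u - (h - c * f k) * u := by ring
    rw [this]
    exact Ideal.sub_mem _ hu (Ideal.mul_mem_right _ _ hh)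
  · rw [Function.update_of_ne hk]
    exact hf k u

end Replacement

/-! ### Regular sequences of quadrics and quadrics modulo linear forms -/

section

variable {K : Type*} [Field K]

theorem isQuadraticRegularSequence_iff {n : ℕ} {f : Fin n → MvPolynomial (Fin n) K} :
    IsQuadraticRegularSequence f ↔ (∀ j, (f j).IsHomogeneous 2) ∧ IsSequentiallyRegular f := by
  constructor
  · exact fun h => ⟨h.isHomogeneous, (isWeaklyRegular_ofFn_iff f).1 h.isRegular.1⟩
  · rintro ⟨h, hreg⟩
    refine ⟨h, (isWeaklyRegular_ofFn_iff f).2 hreg, ?_⟩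
    have : Ideal.ofList (List.ofFn f) = Ideal.span (Set.range f) := by
      rw [Ideal.ofList]
      congr 1
      ext; simp [List.mem_ofFn']
    rw [this, smul_eq_mul, Ideal.mul_top]
    exact (span_ne_top_of_isHomogeneous (by
      rintro _ ⟨j, rfl⟩; exact ⟨2, two_pos, h j⟩)).symm

/-- A nonzero element of the span of a regular sequence can be made a member of it. -/
theorem IsSequentiallyRegular.exists_replacement {σ : Type*} {n : ℕ}
    {f : Fin n → MvPolynomial σ K} (hf : IsSequentiallyRegular f) {α : Fin n → K}
    {h : MvPolynomial σ K} (hh : h = ∑ j, C (α j) * f j) (h0 : h ≠ 0) :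
    ∃ i, IsSequentiallyRegular (Function.update f i h) ∧
      Ideal.span (Set.range (Function.update f i h)) = Ideal.span (Set.range f) := by
  classical
  -- Taking the last index with nonzero coefficient leaves only preceding terms in `h - C (α i) * f
  -- i`.
  obtain ⟨i, hi, hmax⟩ : ∃ i, α i ≠ 0 ∧ ∀ j, i < j → α j = 0 := by
    have hne : (Finset.univ.filter fun j => α j ≠ 0).Nonempty := by
      by_contra hemp
      rw [Finset.not_nonempty_iff_eq_empty, Finset.filter_eq_empty_iff] at hemp
      refine h0 (hh.trans (Finset.sum_eq_zero fun j _ => ?_))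
      rw [not_not.1 (hemp (Finset.mem_univ j)), C_0, zero_mul]
    refine ⟨_, (Finset.mem_filter.1 (Finset.max'_mem _ hne)).2, fun j hj => ?_⟩
    by_contra hne'
    exact absurd (Finset.le_max' _ j (Finset.mem_filter.2 ⟨Finset.mem_univ _, hne'⟩))
      (not_le.2 hj)
  have hu : IsUnit (C (α i) : MvPolynomial σ K) := (isUnit_iff_ne_zero.2 hi).map C
  have hm : h - C (α i) * f i ∈ Ideal.span (f '' Set.Iio i) := by
    rw [hh, ← Finset.add_sum_erase _ _ (Finset.mem_univ i), add_sub_cancel_left]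
    refine Ideal.sum_mem _ fun j hj => ?_
    rcases lt_or_gt_of_ne (Finset.ne_of_mem_erase hj) with h1 | h1
    · exact Ideal.mul_mem_left _ _ (Ideal.subset_span ⟨j, h1, rfl⟩)
    · rw [hmax j h1, C_0, zero_mul]; exact Ideal.zero_mem _
  exact ⟨i, hf.update hu hm, span_range_update hu hm⟩

/-- Modulo all but one of the linear forms of a basis, every quadric is a multiple of the square of
the remaining one. -/
theorem exists_sub_C_mul_sq_mem_span {n : ℕ} {v : Fin n → MvPolynomial (Fin (n + 1)) K}
    (hv : ∀ j, (v j).IsHomogeneous 1) (hi : LinearIndependent K v) :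
    ∃ t, t.IsHomogeneous 1 ∧ ∀ q : MvPolynomial (Fin (n + 1)) K, q.IsHomogeneous 2 →
      ∃ κ : K, q - C κ * t ^ 2 ∈ Ideal.span (Set.range v) := by
  have hle : Submodule.span K (Set.range v) ≤ homogeneousSubmodule (Fin (n + 1)) K 1 := by
    rw [Submodule.span_le]
    rintro _ ⟨j, rfl⟩
    exact hv j
  have h1 : Module.finrank K (homogeneousSubmodule (Fin (n + 1)) K 1) = n + 1 := by
    rw [finrank_homogeneousSubmodule]; simp
  obtain ⟨t, ht, htv⟩ : ∃ t ∈ homogeneousSubmodule (Fin (n + 1)) K 1,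
      t ∉ Submodule.span K (Set.range v) := by
    by_contra! h
    have := le_antisymm hle h
    rw [← this, finrank_span_eq_card hi, Fintype.card_fin] at h1
    omega
  have hind : LinearIndependent K (Fin.cons t v : Fin (n + 1) → MvPolynomial (Fin (n + 1)) K) :=
    linearIndependent_finCons.2 ⟨hi, htv⟩
  have hspan : Submodule.span K (Set.range (Fin.cons t v :
      Fin (n + 1) → MvPolynomial (Fin (n + 1)) K)) = homogeneousSubmodule (Fin (n + 1)) K 1 := by
    refine Submodule.eq_of_le_of_finrank_eq ?_ ?_
    · rw [Fin.range_cons, Submodule.span_insert, sup_le_iff]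
      exact ⟨(Submodule.span_singleton_le_iff_mem _ _).2 ht, hle⟩
    · rw [finrank_span_eq_card hind, h1, Fintype.card_fin]
  have hlin : ∀ y ∈ homogeneousSubmodule (Fin (n + 1)) K 1,
      ∃ κ : K, y - C κ * t ∈ Ideal.span (Set.range v) := by
    intro y hy
    rw [← hspan] at hy
    obtain ⟨a, rfl⟩ := (Submodule.mem_span_range_iff_exists_fun K).1 hy
    refine ⟨a 0, ?_⟩
    rw [Fin.sum_univ_succ]
    simp only [Fin.cons_zero, Fin.cons_succ, smul_eq_C_mul, add_sub_cancel_left]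
    exact Ideal.sum_mem _ fun j _ =>
      Ideal.mul_mem_left _ _ (Ideal.subset_span (Set.mem_range_self j))
  refine ⟨t, ht, fun q hq => ?_⟩
  have hq' : q ∈ homogeneousSubmodule (Fin (n + 1)) K 1 * homogeneousSubmodule (Fin (n + 1)) K 1 := by
    rw [← pow_two, homogeneousSubmodule_one_pow]; exact hq
  induction hq' using Submodule.mul_induction_on' with
  | mem_mul_mem y hy z hz =>
    obtain ⟨κ, hκ⟩ := hlin y hy
    obtain ⟨μ, hμ⟩ := hlin z hz
    refine ⟨κ * μ, ?_⟩
    have : y * z - C (κ * μ) * t ^ 2 = (y - C κ * t) * z + C κ * t * (z - C μ * t) := by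
      rw [C_mul]; ring
    rw [this]
    exact Ideal.add_mem _ (Ideal.mul_mem_right _ _ hκ) (Ideal.mul_mem_left _ _ hμ)
  | add y hy z hz ihy ihz =>
    have hom : ∀ y ∈ homogeneousSubmodule (Fin (n + 1)) K 1 *
        homogeneousSubmodule (Fin (n + 1)) K 1, y.IsHomogeneous 2 := fun y hy => by
      rw [← pow_two, homogeneousSubmodule_one_pow] at hy; exact hy
    obtain ⟨κ, hκ⟩ := ihy (hom y hy)
    obtain ⟨μ, hμ⟩ := ihz (hom z hz)
    refine ⟨κ + μ, ?_⟩
    have : y + z - C (κ + μ) * t ^ 2 = (y - C κ * t ^ 2) + (z - C μ * t ^ 2) := by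
      rw [C_add]; ring
    rw [this]
    exact Ideal.add_mem _ hκ hμ

end

/-! ### The degree three part of the ideal -/

section HilbertFunction

variable {K : Type*} [Field K]

/-- Rank–nullity for the map from forms of degree `d` to the quotient, whose kernel is the degree
`d` part of `I`. -/
theorem hilbertFunction_add_finrank {n : ℕ} (I : Ideal (MvPolynomial (Fin n) K)) (d : ℕ) :
    hilbertFunction I d +
      Module.finrank K (homogeneousSubmodule (Fin n) K d ⊓ I.restrictScalars K : Submodule K _) =
    (n + d - 1).choose d := by
  rw [← finrank_homogeneousSubmodule (K := K) n d]
  have h := LinearMap.finrank_range_add_finrank_ker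
    ((Ideal.Quotient.mkₐ K I).toLinearMap.domRestrict (homogeneousSubmodule (Fin n) K d))
  rw [← h]
  congr 1
  · rw [hilbertFunction, gradedPiece, LinearMap.range_domRestrict]
  · have e : homogeneousSubmodule (Fin n) K d ⊓ I.restrictScalars K =
        (LinearMap.ker ((Ideal.Quotient.mkₐ K I).toLinearMap.domRestrict
          (homogeneousSubmodule (Fin n) K d))).map (homogeneousSubmodule (Fin n) K d).subtype := by
      ext x
      simp [Ideal.Quotient.eq_zero_iff_mem, and_comm]
    rw [e, Submodule.finrank_map_subtype_eq]

/-- The quadrics annihilated by `L` modulo `f`, where `L * M` belongs to the regular sequence `f`,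
are the multiples of `M`. -/
theorem KoszulExact.exists_eq_mul_add {σ ι : Type*} [Fintype ι] [DecidableEq ι]
    {f : ι → MvPolynomial σ K} (hk : KoszulExact f) (hf : ∀ j, (f j).IsHomogeneous 2)
    {L M g : MvPolynomial σ K} (hL : L.IsHomogeneous 1) (hM : M.IsHomogeneous 1) {i : ι}
    (hi : f i = L * M) (hg : g.IsHomogeneous 2) (h : L * g ∈ Ideal.span (Set.range f)) :
    ∃ v, v.IsHomogeneous 1 ∧ g - M * v ∈ Ideal.span (Set.range f) := by
  obtain ⟨l, hl, hlg⟩ := exists_homogeneous_coeff (d := 1) hf (hL.mul hg) h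
  -- Multiplying L g = ∑ l_j f_j by `M` and using L M = `f i` yields a relation whose coefficient at
  -- `i` is M l_i − g; Koszul exactness puts it in the ideal.
  obtain ⟨u, hu⟩ := hk.exists_scalar hf (b := fun j => M * l j - if j = i then g else 0)
    (fun j => by
      refine (hM.mul (hl j)).sub ?_
      split_ifs
      exacts [hg, isHomogeneous_zero _ _ _]) (by
      simp only [sub_mul, Finset.sum_sub_distrib, ite_mul, zero_mul, Finset.sum_ite_eq',
        Finset.mem_univ, if_true, mul_assoc, ← Finset.mul_sum, ← hlg, hi]
      ring)
  refine ⟨l i, hl i, ?_⟩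
  have := hu i
  rw [if_pos rfl] at this
  rw [← neg_sub, this]
  exact (Ideal.neg_mem_iff _).2 (Ideal.sum_mem _ fun j _ =>
    Ideal.mul_mem_left _ _ (Ideal.subset_span (Set.mem_range_self j)))

/-- The map `(b, q) ↦ ∑ b_j f_j + M q` on linear forms `b_j` and quadrics `q`. -/
noncomputable def relationMap {n m : ℕ} (f : Fin m → MvPolynomial (Fin n) K) (M : MvPolynomial (Fin n) K) :
    ((Fin m → homogeneousSubmodule (Fin n) K 1) × homogeneousSubmodule (Fin n) K 2) →ₗ[K]
      MvPolynomial (Fin n) K where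
  toFun x := ∑ j, (x.1 j : MvPolynomial (Fin n) K) * f j + M * x.2
  map_add' x y := by
    simp only [Prod.fst_add, Prod.snd_add, Pi.add_apply, Submodule.coe_add, add_mul,
      Finset.sum_add_distrib]
    ring
  map_smul' c x := by
    simp [smul_eq_C_mul, Finset.mul_sum, mul_assoc, mul_left_comm]

/-- The map `κ ↦ (κ_j M, - ∑ κ_j f_j)`. -/
noncomputable def relationKernelMap {n m : ℕ} {f : Fin m → MvPolynomial (Fin n) K}
    (hf : ∀ j, (f j).IsHomogeneous 2) {M : MvPolynomial (Fin n) K} (hM : M.IsHomogeneous 1) :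
    (Fin m → K) →ₗ[K]
      ((Fin m → homogeneousSubmodule (Fin n) K 1) × homogeneousSubmodule (Fin n) K 2) where
  toFun κ := (fun j => κ j • ⟨M, hM⟩, - ∑ j, κ j • ⟨f j, hf j⟩)
  map_add' x y := by
    ext1
    · ext1 j; simp [add_smul]
    · simp [add_smul, Finset.sum_add_distrib]; abel
  map_smul' c x := by
    ext1
    · ext1 j; simp [mul_smul]
    · simp [mul_smul, Finset.smul_sum]

/-- Multiplication by `L` turns M q into q `f i`, and an element of the kernel into a relation on
the full sequence `f`, where Koszul exactness applies. -/
theorem KoszulExact.ker_relationMap {n m : ℕ} {f : Fin (m + 1) → MvPolynomial (Fin n) K}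
    (hk : KoszulExact f) (hf : ∀ j, (f j).IsHomogeneous 2) {L M : MvPolynomial (Fin n) K}
    (hL : L.IsHomogeneous 1) (hM : M.IsHomogeneous 1) (hM0 : M ≠ 0) {i : Fin (m + 1)}
    (hi : f i = L * M) :
    LinearMap.ker (relationMap (fun j => f (i.succAbove j)) M) =
      LinearMap.range (relationKernelMap (fun j => hf (i.succAbove j)) hM) := by
  ext x
  rw [LinearMap.mem_ker, LinearMap.mem_range]
  constructor
  · intro hx
    change ∑ j, (x.1 j : MvPolynomial (Fin n) K) * f (i.succAbove j) + M * x.2 = 0 at hx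
    have hb : ∀ j, (x.1 j : MvPolynomial (Fin n) K).IsHomogeneous 1 := fun j => (x.1 j).2
    have hq : (x.2 : MvPolynomial (Fin n) K).IsHomogeneous 2 := x.2.2
    obtain ⟨u, hu⟩ := hk.exists_scalar hf
      (b := i.insertNth (x.2 : MvPolynomial (Fin n) K)
        fun j => L * (x.1 j : MvPolynomial (Fin n) K))
      (fun j => by
        rcases Fin.eq_self_or_eq_succAbove i j with rfl | ⟨j, rfl⟩
        · simpa using hq
        · simpa using hL.mul (hb j)) (by
        rw [Fin.sum_univ_succAbove _ i]
        simp only [Fin.insertNth_apply_same, Fin.insertNth_apply_succAbove, mul_assoc,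
          ← Finset.mul_sum, hi]
        linear_combination L * hx)
    have hκ : ∀ j, (x.1 j : MvPolynomial (Fin n) K) =
        C (u (i.succAbove j) i - u i (i.succAbove j)) * M := by
      intro j
      have h1 := hu (i.succAbove j)
      rw [Fin.insertNth_apply_succAbove] at h1
      -- Both L b_j and L M = `f i` lie in the span of `f`, so b_j is a scalar multiple of `M`.
      have := hk.mul_eq_mul hf hM (hb j) (α := Pi.single i 1)
        (by simp [Pi.single_apply, apply_ite (C : K → MvPolynomial (Fin n) K), hi]) h1 i
      simpa using this.symm
    refine ⟨fun j => u (i.succAbove j) i - u i (i.succAbove j), ?_⟩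
    refine Prod.ext (funext fun j => Subtype.ext ?_) (Subtype.ext ?_)
    · rw [hκ]
      simp [relationKernelMap, smul_eq_C_mul]
    · refine mul_left_cancel₀ hM0 ?_
      have : M * (x.2 : MvPolynomial (Fin n) K) =
        M * - ∑ j, C (u (i.succAbove j) i - u i (i.succAbove j)) * f (i.succAbove j) := by
        rw [eq_neg_of_add_eq_zero_right hx, mul_neg, Finset.mul_sum]
        congr 1
        exact Finset.sum_congr rfl fun j _ => by rw [hκ]; ring
      rw [this]
      simp [relationKernelMap, smul_eq_C_mul]
  · rintro ⟨κ, rfl⟩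
    simp only [relationMap, relationKernelMap, LinearMap.coe_mk, AddHom.coe_mk]
    simp [smul_eq_C_mul, Finset.mul_sum, mul_assoc, mul_left_comm]

theorem finrank_range_relationMap {f : Fin 5 → MvPolynomial (Fin 5) K}
    (hk : KoszulExact f) (hf : ∀ j, (f j).IsHomogeneous 2) {L M : MvPolynomial (Fin 5) K}
    (hL : L.IsHomogeneous 1) (hM : M.IsHomogeneous 1) (hM0 : M ≠ 0) {i : Fin 5}
    (hi : f i = L * M) :
    Module.finrank K (LinearMap.range (relationMap (fun j => f (i.succAbove j)) M)) = 31 := by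
  have h := LinearMap.finrank_range_add_finrank_ker (relationMap (fun j => f (i.succAbove j)) M)
  rw [hk.ker_relationMap hf hL hM hM0 hi, LinearMap.finrank_range_of_inj
    (f := relationKernelMap (fun j => hf (i.succAbove j)) hM), Module.finrank_prod,
    Module.finrank_pi_fintype, Module.finrank_pi_fintype, finrank_homogeneousSubmodule,
    finrank_homogeneousSubmodule] at h
  -- The source has dimension 4·5 + 15 = 35 and the kernel has dimension 4.
  · simp [Nat.choose] at h
    omega
  · rw [← LinearMap.ker_eq_bot, LinearMap.ker_eq_bot']
    intro κ hκ
    funext j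
    have := congrArg Subtype.val (congrFun (congrArg Prod.fst hκ) j)
    simpa [relationKernelMap, hM0] using this

/-- The degree three part of the ideal `(f, g)`. -/
theorem range_relationMap_eq {f : Fin 5 → MvPolynomial (Fin 5) K}
    {g : Fin 3 → MvPolynomial (Fin 5) K} (hreg : IsSequentiallyRegular f)
    (hf : ∀ j, (f j).IsHomogeneous 2) (hg : ∀ k, (g k).IsHomogeneous 2)
    (hfg : ∀ c : Fin 3 → K, ∑ k, C (c k) * g k ∈ Ideal.span (Set.range f) → ∀ k, c k = 0)
    {L M : MvPolynomial (Fin 5) K}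
    (hL : L.IsHomogeneous 1) (hM : M.IsHomogeneous 1) (hL0 : L ≠ 0) {i : Fin 5}
    (hi : f i = L * M) (hLg : ∀ k, L * g k ∈ Ideal.span (Set.range f)) :
    LinearMap.range (relationMap (fun j => f (i.succAbove j)) M) =
      homogeneousSubmodule (Fin 5) K 3 ⊓
        (Ideal.span (Set.range f) ⊔ Ideal.span (Set.range g)).restrictScalars K := by
  choose v hv hgv using fun k => hreg.koszulExact.exists_eq_mul_add hf hL hM hi (hg k) (hLg k)
  set I := Ideal.span (Set.range f) ⊔ Ideal.span (Set.range g) with hI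
  have hfI : ∀ j, f j ∈ I := fun j =>
    Ideal.mem_sup_left (Ideal.subset_span (Set.mem_range_self j))
  have hgI : ∀ k, g k ∈ I := fun k =>
    Ideal.mem_sup_right (Ideal.subset_span (Set.mem_range_self k))
  -- A dependency multiplied by `M` puts a combination of the `g k` in the ideal of `f`, since M L =
  -- `f i` and M v_k ≡ g_k.
  have hind : LinearIndependent K (Fin.cons L v : Fin 4 → MvPolynomial (Fin 5) K) := by
    rw [Fintype.linearIndependent_iff]
    intro c hc
    rw [Fin.sum_univ_succ] at hc
    simp only [Fin.cons_zero, Fin.cons_succ, smul_eq_C_mul] at hc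
    have h1 : ∑ k, C (c (Fin.succ k)) * g k ∈ Ideal.span (Set.range f) := by
      have : ∑ k, C (c (Fin.succ k)) * g k =
          ∑ k, C (c (Fin.succ k)) * (g k - M * v k) - C (c 0) * f i := by
        have e : ∑ k : Fin 3, C (c (Fin.succ k)) * (g k - M * v k) =
            ∑ k, C (c (Fin.succ k)) * g k - M * ∑ k, C (c (Fin.succ k)) * v k := by
          rw [Finset.mul_sum, ← Finset.sum_sub_distrib]
          exact Finset.sum_congr rfl fun k _ => by ring
        rw [e, hi]
        linear_combination M * hc
      rw [this]
      exact Ideal.sub_mem _ (Ideal.sum_mem _ fun k _ => Ideal.mul_mem_left _ _ (hgv k))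
        (Ideal.mul_mem_left _ _ (Ideal.subset_span (Set.mem_range_self i)))
    have h2 := hfg _ h1
    simp only [h2, C_0, zero_mul, Finset.sum_const_zero, add_zero, mul_eq_zero, hL0, or_false,
      C_eq_zero] at hc
    exact fun j => Fin.cases hc h2 j
  have hhom : ∀ j, ((Fin.cons L v : Fin 4 → MvPolynomial (Fin 5) K) j).IsHomogeneous 1 :=
    fun j => Fin.cases (by simpa using hL) (by simpa using hv) j
  obtain ⟨t, -, ht⟩ := exists_sub_C_mul_sq_mem_span hhom hind
  have hMspan : ∀ x ∈ Ideal.span (Set.range (Fin.cons L v : Fin 4 → MvPolynomial (Fin 5) K)),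
      M * x ∈ I := by
    intro x hx
    obtain ⟨c, rfl⟩ := (Ideal.mem_span_range_iff_exists_fun).1 hx
    rw [Finset.mul_sum]
    refine Ideal.sum_mem _ fun j _ => ?_
    rw [mul_left_comm]
    refine Ideal.mul_mem_left _ _ ?_
    refine Fin.cases ?_ (fun k => ?_) j
    · rw [Fin.cons_zero, mul_comm, ← hi]; exact hfI i
    · rw [Fin.cons_succ, ← sub_sub_cancel (g k) (M * v k)]
      exact Ideal.sub_mem _ (hgI k) (Ideal.mem_sup_left (hgv k))
  -- Some `f p` is outside the ideal of the four linear forms, hence a nonzero multiple of t² modulo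
  -- them; this brings M t² into `I`.
  obtain ⟨p, hp⟩ := hreg.exists_notMem
    (Set.range (Fin.cons L v : Fin 4 → MvPolynomial (Fin 5) K)) (Set.finite_range _)
    (by
      rw [← Set.image_univ]
      exact (Set.ncard_image_le Set.finite_univ).trans_lt (by simp))
    (by rintro _ ⟨j, rfl⟩; exact ⟨1, one_pos, hhom j⟩)
  have hMq : ∀ q : MvPolynomial (Fin 5) K, q.IsHomogeneous 2 → M * q ∈ I := by
    intro q hq
    obtain ⟨κ, hκ⟩ := ht q hq
    obtain ⟨μ, hμ⟩ := ht _ (hf p)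
    have hμ0 : μ ≠ 0 := by
      rintro rfl
      exact hp (by simpa using hμ)
    have h1 : M * (q - C κ * t ^ 2 - C (κ / μ) * (f p - C μ * t ^ 2)) ∈ I :=
      hMspan _ (Ideal.sub_mem _ hκ (Ideal.mul_mem_left _ _ hμ))
    have hC : (C κ : MvPolynomial (Fin 5) K) = C (κ / μ) * C μ := by
      rw [← C_mul, div_mul_cancel₀ _ hμ0]
    have h2 : M * q = M * (q - C κ * t ^ 2 - C (κ / μ) * (f p - C μ * t ^ 2)) +
        M * C (κ / μ) * f p := by
      rw [hC]; ring
    rw [h2]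
    exact Ideal.add_mem _ h1 (Ideal.mul_mem_left _ _ (hfI p))
  apply le_antisymm
  · rintro _ ⟨x, rfl⟩
    change ∑ j, (x.1 j : MvPolynomial (Fin 5) K) * f (i.succAbove j) + M * x.2 ∈ _
    refine ⟨?_, ?_⟩
    · exact (IsHomogeneous.sum _ _ _ fun j _ => (x.1 j).2.mul (hf _)).add (hM.mul x.2.2)
    · exact Ideal.add_mem _ (Ideal.sum_mem _ fun j _ => Ideal.mul_mem_left _ _ (hfI _))
        (hMq _ x.2.2)
  · rintro x ⟨hx3, hxI⟩
    set T := LinearMap.range (relationMap (fun j => f (i.succAbove j)) M) with hT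
    have hTM : ∀ q : MvPolynomial (Fin 5) K, q.IsHomogeneous 2 → M * q ∈ T := fun q hq =>
      ⟨(0, ⟨q, hq⟩), by simp [relationMap]⟩
    have hTf : ∀ (b : MvPolynomial (Fin 5) K) j, b.IsHomogeneous 1 → b * f j ∈ T := by
      intro b j hb
      rcases Fin.eq_self_or_eq_succAbove i j with rfl | ⟨j, rfl⟩
      · rw [hi]
        have := hTM _ (hb.mul hL)
        rwa [show b * (L * M) = M * (b * L) by ring]
      · refine ⟨(Pi.single j ⟨b, hb⟩, 0), ?_⟩
        change ∑ k, ((Pi.single j ⟨b, hb⟩ : Fin 4 → homogeneousSubmodule (Fin 5) K 1) k :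
          MvPolynomial (Fin 5) K) * f (i.succAbove k) + M * 0 = _
        rw [Finset.sum_eq_single j (fun k _ hk => by rw [Pi.single_eq_of_ne hk]; simp) (by simp)]
        simp
    have hTg : ∀ (b : MvPolynomial (Fin 5) K) k, b.IsHomogeneous 1 → b * g k ∈ T := by
      intro b k hb
      obtain ⟨d, hd⟩ := exists_scalar_coeff hf ((hg k).sub (hM.mul (hv k))) (hgv k)
      have : b * g k = ∑ j, C (d j) * b * f j + M * (b * v k) := by
        have e : ∑ j, C (d j) * b * f j = b * ∑ j, C (d j) * f j := by
          rw [Finset.mul_sum]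
          exact Finset.sum_congr rfl fun j _ => by ring
        rw [e, ← hd]; ring
      rw [this]
      exact T.add_mem (T.sum_mem fun j _ => hTf _ _ (hb.C_mul _)) (hTM _ (hb.mul (hv k)))
    have hIr : I = Ideal.span (Set.range (Sum.elim f g)) := by
      rw [hI, Set.Sum.elim_range, Ideal.span_union]
    change x ∈ I at hxI
    rw [hIr] at hxI
    obtain ⟨c, hc, rfl⟩ := exists_homogeneous_coeff (d := 1) (m := 2)
      (fun j => by rcases j with j | k; exacts [hf j, hg k]) hx3 hxI
    rw [Fintype.sum_sum_type]
    exact T.add_mem (T.sum_mem fun j _ => hTf _ _ (hc _)) (T.sum_mem fun k _ => hTg _ _ (hc _))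

end HilbertFunction

/-! ### The theorem -/

theorem mem_linearAnnihilator {K : Type*} [Field K] {n δ : ℕ}
    {f : Fin n → MvPolynomial (Fin n) K} {g : Fin δ → MvPolynomial (Fin n) K}
    {L : MvPolynomial (Fin n) K}
    (h : Ideal.Quotient.mk (Ideal.span (Set.range f)) L ∈ linearAnnihilator f g) (k : Fin δ) :
    L * g k ∈ Ideal.span (Set.range f) := by
  have h2 := h.2
  rw [SetLike.mem_coe, Submodule.restrictScalars_mem, Submodule.mem_annihilator] at h2
  have := h2 (Ideal.Quotient.mk _ (g k))
    (Ideal.mem_map_of_mem _ (Ideal.subset_span (Set.mem_range_self k)))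
  rwa [smul_eq_mul, ← map_mul, Ideal.Quotient.eq_zero_iff_mem] at this

theorem mainTheorem8 {K : Type*} [Field K]
    (f : Fin 5 → MvPolynomial (Fin 5) K) (g : Fin 3 → MvPolynomial (Fin 5) K)
    (hI : IsDefectQuadratic f g)
    (hAnn : Module.finrank K (linearAnnihilator f g) = 1) :
    hilbertFunction (Ideal.span (Set.range f) ⊔ Ideal.span (Set.range g)) 3 = 4 ∧
    ∀ L : MvPolynomial (Fin 5) K, L.IsHomogeneous 1 →
      linearAnnihilator f g =
        Submodule.span K {Ideal.Quotient.mk (Ideal.span (Set.range f)) L} →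
      ∃ f' : Fin 5 → MvPolynomial (Fin 5) K,
        IsQuadraticRegularSequence f' ∧
        Ideal.span (Set.range f') = Ideal.span (Set.range f) ∧
        ∃ i, L ∣ f' i := by
  obtain ⟨hf, hreg⟩ := isQuadraticRegularSequence_iff.1 hI.regular
  have hg := hI.isHomogeneous
  have hfg : ∀ c : Fin 3 → K, ∑ k, C (c k) * g k ∈ Ideal.span (Set.range f) → ∀ k, c k = 0 := by
    intro c hc
    obtain ⟨d, hd⟩ := exists_scalar_coeff hf
      (IsHomogeneous.sum _ _ _ fun i _ => (hg i).C_mul (c i)) hc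
    have := Fintype.linearIndependent_iff.1 hI.linearIndependent (Sum.elim (fun j => - d j) c) (by
      simp [smul_eq_C_mul, hd])
    exact fun i => this (Sum.inr i)
  -- the key step: `f` may be replaced by a regular sequence containing a multiple of `L`
  have key : ∀ L : MvPolynomial (Fin 5) K, L.IsHomogeneous 1 → L ≠ 0 →
      (∀ k, L * g k ∈ Ideal.span (Set.range f)) →
      ∃ (f' : Fin 5 → MvPolynomial (Fin 5) K) (M : MvPolynomial (Fin 5) K) (i : Fin 5),
        (∀ j, (f' j).IsHomogeneous 2) ∧ IsSequentiallyRegular f' ∧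
        Ideal.span (Set.range f') = Ideal.span (Set.range f) ∧ M.IsHomogeneous 1 ∧ M ≠ 0 ∧
        f' i = L * M := by
    intro L hL hL0 hLg
    obtain ⟨M, hM, hM0, α, hα⟩ := exists_linear_multiple_mem_span hreg hf hg
      hI.linearIndependent hL hL0 hLg
    obtain ⟨i, h1, h2⟩ := hreg.exists_replacement hα (mul_ne_zero hL0 hM0)
    refine ⟨Function.update f i (L * M), M, i, fun j => ?_, h1, h2, hM, hM0,
      Function.update_self _ _ _⟩
    by_cases hj : j = i
    · subst hj
      rw [Function.update_self]
      exact hL.mul hM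
    · rw [Function.update_of_ne hj]
      exact hf j
  constructor
  · obtain ⟨x, hx0⟩ : ∃ x : linearAnnihilator f g, x ≠ 0 := by
      have : Nontrivial (linearAnnihilator f g) :=
        Module.nontrivial_of_finrank_pos (R := K) (by rw [hAnn]; exact one_pos)
      exact exists_ne 0
    obtain ⟨L, hL, hLx⟩ := x.2.1
    have hLx' : Ideal.Quotient.mk (Ideal.span (Set.range f)) L = x := hLx
    have hL0 : L ≠ 0 := by
      rintro rfl
      exact hx0 (Subtype.ext (by rw [← hLx', map_zero]; rfl))
    have hLg := mem_linearAnnihilator (f := f) (g := g) (L := L) (by rw [hLx']; exact x.2)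
    obtain ⟨f', M, i, hf', hreg', hspan, hM, hM0, hi⟩ := key L hL hL0 hLg
    have h31 := finrank_range_relationMap hreg'.koszulExact hf' hL hM hM0 hi
    rw [range_relationMap_eq hreg' hf' hg (by rw [hspan]; exact hfg) hL hM hL0 hi
      (by rw [hspan]; exact hLg), hspan] at h31
    -- Cubics in five variables have dimension 35, so the value is 35 − 31.
    have := hilbertFunction_add_finrank
      (Ideal.span (Set.range f) ⊔ Ideal.span (Set.range g)) 3
    rw [h31] at this
    simp [Nat.choose] at this
    exact this
  · intro L hL hLspan
    have hL0 : L ≠ 0 := by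
      rintro rfl
      rw [hLspan, map_zero, Submodule.span_zero_singleton, finrank_bot] at hAnn
      exact zero_ne_one hAnn
    have hLg := mem_linearAnnihilator (f := f) (g := g) (L := L)
      (by rw [hLspan]; exact Submodule.mem_span_singleton_self _)
    obtain ⟨f', M, i, hf', hreg', hspan, -, -, hi⟩ := key L hL hL0 hLg
    exact ⟨f', isQuadraticRegularSequence_iff.2 ⟨hf', hreg'⟩, hspan, i, hi ▸ Dvd.intro _ rfl⟩
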